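/- Let $0<q<1$, and write $(x;q)_n=\prod_{k=0}^{n-1}(1-xq^k)$, $(x;q)_\infty=\prod_{k=0}^{\infty}(1-xq^k)$, $(x_1,\dots,x_m;q)_n=\prod_{i=1}^m (x_i;q)_n$ for $n\in\{0,1,2,\dots\}\cup\{\infty\}$, $$h(x;a|q)=\prod_{k=0}^\infty(1-2q^kax+q^{2k}a^2),\qquad h(x;a_1,\dots,a_m|q)=\prod_{i=1}^m h(x;a_i|q),$$ $${}_3\phi_2\left({a_1,a_2,a_3\atop b_1,b_2};q,z\right)=\sum_{n=0}^\infty\frac{(a_1,a_2,a_3;q)_n}{(q,b_1,b_2;q)_n}z^n .$$ Let $a,b,c,d,r,u,v$ be complex numbers with $\max\{|a|,|b|,|c|,|d|,|r|\}<1$ and $u,v\neq 0$, and put $\alpha=a^2bcdr/q$. Assume that $\alpha\ne 1$ and that $\alpha uq^k\neq1$ and $\alpha vq^k\ne 1$ for all integers $k\ge 0$. Then the integrand below is integrable on $[0,\pi]$, the ${}_3\phi_2$ series (for every real $\theta$) and the series on the right-hand side converge absolutely, and \begin{align*} &\int_0^\pi\frac{h(\cos2\theta;1|q)}{h(\cos\theta;a,b,c,d,r|q)}\,{}_3\phi_2\left({ae^{i\theta},ae^{-i\theta},\alpha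 uv/q\atop \alpha u,\alpha v};q,bcdr\right)d\theta\\ &=\frac{2\pi(abcd,abcr,abdr,acdr;q)_\infty}{(q,ab,ac,ad,ar,bc,bd,br,cd,cr,dr,a^2bcdr;q)_\infty}\\ &\quad\times\sum_{n=0}^\infty\frac{(1-\alpha q^{2n})(\alpha,ab,ac,ad,ar,q/u,q/v;q)_n}{(1-\alpha)(q,abcd,abcr,abdr,acdr,\alpha u,\alpha v;q)_n}\left(-\frac{\alpha bcdruv}{q}\right)^nq^{n(n-1)/2}. \end{align*} -/

import Mathlib

noncomputable section

/-- The finite `q`-shifted factorial `(a; q)_n = ∏_{k=0}^{n-1} (1 - a q^k)`. -/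
def qPoch (q : ℝ) (a : ℂ) (n : ℕ) : ℂ :=
  ∏ k ∈ Finset.range n, (1 - a * (q : ℂ) ^ k)

/-- The infinite `q`-shifted factorial `(a; q)_∞ = ∏_{k=0}^∞ (1 - a q^k)`
(the product converges absolutely for `|q| < 1`, see `multipliable_qPochInf`). -/
def qPochInf (q : ℝ) (a : ℂ) : ℂ :=
  ∏' k : ℕ, (1 - a * (q : ℂ) ^ k)

theorem multipliable_qPochInf {q : ℝ} (h0 : 0 < q) (h1 : q < 1) (a : ℂ) :
    Multipliable (fun k : ℕ => 1 - a * (q : ℂ) ^ k) := by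
  have hs : Summable (fun k : ℕ => ‖-(a * (q : ℂ) ^ k)‖) := by
    have h : Summable (fun k : ℕ => ‖a‖ * q ^ k) :=
      (summable_geometric_of_lt_one h0.le h1).mul_left _
    refine h.congr fun k => ?_
    simp [abs_of_pos h0]
  simpa [sub_eq_add_neg] using multipliable_one_add_of_summable hs

/-- The multiple symbol `(a_1, ..., a_m; q)_n = (a_1; q)_n ⋯ (a_m; q)_n`. -/
def qPochs {m : ℕ} (q : ℝ) (a : Fin m → ℂ) (n : ℕ) : ℂ :=
  ∏ i, qPoch q (a i) n

/-- The multiple symbol `(a_1, ..., a_m; q)_∞ = (a_1; q)_∞ ⋯ (a_m; q)_∞`. -/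
def qPochInfs {m : ℕ} (q : ℝ) (a : Fin m → ℂ) : ℂ :=
  ∏ i, qPochInf q (a i)

/-- The `n`-th term `(a_1, ..., a_{r+1}; q)_n z^n / (q, b_1, ..., b_r; q)_n` of the basic
hypergeometric series `_{r+1}φ_r`. -/
def basicHypTerm {r : ℕ} (a : Fin (r + 1) → ℂ) (b : Fin r → ℂ) (q : ℝ) (z : ℂ) (n : ℕ) : ℂ :=
  qPochs q a n * z ^ n / (qPoch q (q : ℂ) n * qPochs q b n)

/-- The basic hypergeometric series `_{r+1}φ_r(a_1, ..., a_{r+1}; b_1, ..., b_r; q, z)`. -/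
def basicHyp {r : ℕ} (a : Fin (r + 1) → ℂ) (b : Fin r → ℂ) (q : ℝ) (z : ℂ) : ℂ :=
  ∑' n : ℕ, basicHypTerm a b q z n

/-- `h(x; a | q) = ∏_{k=0}^∞ (1 - 2 q^k a x + q^{2k} a^2)`; for `x = cos θ` the `k`-th factor is
`(1 - a e^{iθ} q^k) (1 - a e^{-iθ} q^k)`. -/
def hProd (x : ℝ) (a : ℂ) (q : ℝ) : ℂ :=
  ∏' k : ℕ, (1 - 2 * (q : ℂ) ^ k * a * (x : ℂ) + (q : ℂ) ^ (2 * k) * a ^ 2)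

theorem hProd_cos {q : ℝ} (h0 : 0 < q) (h1 : q < 1) (θ : ℝ) (a : ℂ) :
    hProd (Real.cos θ) a q =
      qPochInf q (a * Complex.exp (θ * Complex.I)) *
        qPochInf q (a * Complex.exp (-(θ * Complex.I))) := by
  unfold hProd qPochInf
  rw [← (multipliable_qPochInf h0 h1 _).tprod_mul (multipliable_qPochInf h0 h1 _)]
  refine tprod_congr fun k => ?_
  have he : Complex.exp (θ * Complex.I) * Complex.exp (-(θ * Complex.I)) = 1 := by
    rw [← Complex.exp_add]; simp
  have hc : 2 * ((Real.cos θ : ℝ) : ℂ) =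
      Complex.exp (θ * Complex.I) + Complex.exp (-(θ * Complex.I)) := by
    rw [Complex.ofReal_cos, Complex.two_cos, neg_mul]
  linear_combination (-(q : ℂ) ^ k * a) * hc - a ^ 2 * (q : ℂ) ^ (2 * k) * he

/-- `h(x; a_1, ..., a_m | q) = h(x; a_1 | q) ⋯ h(x; a_m | q)`. -/
def hProds {m : ℕ} (x : ℝ) (a : Fin m → ℂ) (q : ℝ) : ℂ :=
  ∏ i, hProd x (a i) q

end

/-! Put `z = e^{iθ}`, `s = bcdr` and `αq = a²bcdr`. The evaluation rests on expanding the `₃φ₂` in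
the integrand into a series whose terms, multiplied by the weight, are integrands of Rahman's
`q`-beta integral with `a` replaced by `aq^k`, and then integrating term by term.

The expansion is a limiting case of Watson's transformation (`tsum_watson_limit`). The quotient
`(αuv/q;q)_n / (q,αu,αv;q)_n` is the second member of a Bailey pair, hence a finite sum over `k ≤ n`
(`sum_baileyTerm`, proved by creative telescoping). After the two sums are interchanged, the inner
one is a `q`-Gauss series (`tsum_qGaussTerm`), because `(az)(a/z)s = αq`. It yields infinite
products in `aszq^k` and `asq^k/z`, exactly the numerator that Rahman's kernel requires
(`rahmanKernel_mul_pow`).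

Rahman's integral (`circleAverage_rahmanKernel`) is evaluated on the unit circle. The kernels for
`a` and `aq`, with suitable coefficients, differ by a multiple of `F(z) + F(1/z)`, where `F(qz) =
-F(1/z)` and `F` is holomorphic on `q ≤ |z| ≤ 1`; hence `F` has mean zero. Iterating `a → aq` sends
`a` to `0`. Doing so for every parameter leaves one constant depending on `q` only, which is read
off from a choice of parameters that makes the kernel a Laurent polynomial.

The interchanges of sum and integral follow from the factor `q^{k(k-1)/2}` in `baileyAlpha` and from
a bound on the kernels that is uniform in `k` and `θ`. -/

open Filter Topology

/-! ### Finite and infinite `q`-shifted factorials: algebra, analyticity and uniform bounds -/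

section QPochhammer

variable {q : ℝ}

theorem qPoch_zero_right (q : ℝ) (a : ℂ) : qPoch q a 0 = 1 := by simp [qPoch]

theorem qPoch_zero_left (q : ℝ) (n : ℕ) : qPoch q 0 n = 1 := by simp [qPoch]

theorem qPoch_succ (q : ℝ) (a : ℂ) (n : ℕ) :
    qPoch q a (n + 1) = qPoch q a n * (1 - a * (q : ℂ) ^ n) :=
  Finset.prod_range_succ _ _

theorem qPoch_add (q : ℝ) (a : ℂ) (m n : ℕ) :
    qPoch q a (m + n) = qPoch q a m * qPoch q (a * (q : ℂ) ^ m) n := by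
  simp only [qPoch, Finset.prod_range_add, pow_add, mul_assoc]

theorem qPoch_succ' (q : ℝ) (a : ℂ) (n : ℕ) :
    qPoch q a (n + 1) = (1 - a) * qPoch q (a * q) n := by
  rw [add_comm, qPoch_add]; simp [qPoch]

theorem qPoch_ne_zero {a : ℂ} (h : ∀ k : ℕ, a * (q : ℂ) ^ k ≠ 1) (n : ℕ) : qPoch q a n ≠ 0 :=
  Finset.prod_ne_zero_iff.2 fun k _ => sub_ne_zero.2 (h k).symm

theorem qPochInf_zero (q : ℝ) : qPochInf q 0 = 1 := by simp [qPochInf]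

theorem mul_pow_ne_one (h0 : 0 < q) (h1 : q < 1) {a : ℂ} (ha : ‖a‖ < 1) (k : ℕ) :
    a * (q : ℂ) ^ k ≠ 1 := by
  intro h
  have h2 : ‖a * (q : ℂ) ^ k‖ = 1 := by rw [h]; simp
  rw [norm_mul, norm_pow, Complex.norm_real, Real.norm_of_nonneg h0.le] at h2
  have : q ^ k ≤ 1 := pow_le_one₀ h0.le h1.le
  have h3 : 0 < q ^ k := pow_pos h0 k
  nlinarith [norm_nonneg a]

theorem norm_mul_pow_lt_one (h0 : 0 < q) (h1 : q < 1) {a : ℂ} (ha : ‖a‖ < 1) (k : ℕ) :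
    ‖a * (q : ℂ) ^ k‖ < 1 := by
  rw [norm_mul, norm_pow, Complex.norm_real, Real.norm_of_nonneg h0.le]
  have : q ^ k ≤ 1 := pow_le_one₀ h0.le h1.le
  nlinarith [norm_nonneg a, pow_pos h0 k]

theorem norm_ofReal_lt_one (h0 : 0 < q) (h1 : q < 1) : ‖(q : ℂ)‖ < 1 := by
  rwa [Complex.norm_real, Real.norm_of_nonneg h0.le]

theorem tendsto_mul_pow_zero (h0 : 0 < q) (h1 : q < 1) (a : ℂ) :
    Tendsto (fun n : ℕ => a * (q : ℂ) ^ n) atTop (𝓝 0) := by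
  simpa using (tendsto_pow_atTop_nhds_zero_of_norm_lt_one
    (norm_ofReal_lt_one h0 h1)).const_mul a

theorem qPoch_ne_zero_of_norm_lt (h0 : 0 < q) (h1 : q < 1) {a : ℂ} (ha : ‖a‖ < 1) (n : ℕ) :
    qPoch q a n ≠ 0 :=
  qPoch_ne_zero (mul_pow_ne_one h0 h1 ha) n

theorem summable_norm_mul_pow (h0 : 0 < q) (h1 : q < 1) (a : ℂ) :
    Summable fun k : ℕ => ‖-(a * (q : ℂ) ^ k)‖ := by
  refine ((summable_geometric_of_lt_one h0.le h1).mul_left ‖a‖).congr fun k => ?_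
  simp [abs_of_pos h0]

theorem qPochInf_ne_zero (h0 : 0 < q) (h1 : q < 1) {a : ℂ} (h : ∀ k : ℕ, a * (q : ℂ) ^ k ≠ 1) :
    qPochInf q a ≠ 0 := by
  simp only [qPochInf, sub_eq_add_neg]
  refine tprod_one_add_ne_zero_of_summable (fun k => ?_) (summable_norm_mul_pow h0 h1 a)
  rw [← sub_eq_add_neg]
  exact sub_ne_zero.2 (h k).symm

theorem qPochInf_ne_zero_of_norm_lt (h0 : 0 < q) (h1 : q < 1) {a : ℂ} (ha : ‖a‖ < 1) :
    qPochInf q a ≠ 0 :=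
  qPochInf_ne_zero h0 h1 (mul_pow_ne_one h0 h1 ha)

theorem qPochInf_eq_mul (h0 : 0 < q) (h1 : q < 1) (a : ℂ) (n : ℕ) :
    qPochInf q a = qPoch q a n * qPochInf q (a * (q : ℂ) ^ n) := by
  have h : Multipliable fun k : ℕ => 1 - a * (q : ℂ) ^ (k + n) := by
    simpa only [pow_add, mul_assoc, mul_comm, mul_left_comm] using
      multipliable_qPochInf h0 h1 (a * (q : ℂ) ^ n)
  rw [qPochInf, ← Multipliable.prod_mul_tprod_nat_mul' (f := fun k : ℕ => 1 - a * (q : ℂ) ^ k) h]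
  simp only [qPoch, qPochInf, pow_add, mul_assoc, mul_comm]

theorem qPochInf_eq_one_sub_mul (h0 : 0 < q) (h1 : q < 1) (a : ℂ) :
    qPochInf q a = (1 - a) * qPochInf q (a * q) := by
  simpa [qPoch] using qPochInf_eq_mul h0 h1 a 1

theorem tendsto_qPoch (h0 : 0 < q) (h1 : q < 1) (a : ℂ) :
    Tendsto (fun n => qPoch q a n) atTop (𝓝 (qPochInf q a)) :=
  (multipliable_qPochInf h0 h1 a).hasProd.tendsto_prod_nat

/-- On each ball the product converges locally uniformly, being dominated by a geometric series, so
the limit of the polynomial partial products is holomorphic. -/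
theorem differentiable_qPochInf (h0 : 0 < q) (h1 : q < 1) : Differentiable ℂ (qPochInf q) := by
  intro a
  have h : HasProdLocallyUniformlyOn (fun (k : ℕ) (x : ℂ) => 1 + -(x * (q : ℂ) ^ k))
      (fun x => ∏' k : ℕ, (1 + -(x * (q : ℂ) ^ k))) (Metric.ball 0 (‖a‖ + 1)) := by
    refine Summable.hasProdLocallyUniformlyOn_nat_one_add Metric.isOpen_ball
      ((summable_geometric_of_lt_one h0.le h1).mul_left (‖a‖ + 1))
      (Eventually.of_forall fun n x hx => ?_) fun n => by fun_prop
    rw [norm_neg, norm_mul, norm_pow, Complex.norm_real, Real.norm_of_nonneg h0.le]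
    gcongr
    exact (mem_ball_zero_iff.1 hx).le
  have h2 := h.differentiableOn (.of_forall fun s => by
    simpa [Finset.prod_fn] using DifferentiableOn.finsetProd (fun _ _ ↦ by fun_prop))
    Metric.isOpen_ball
  have h3 := h2.differentiableAt (Metric.isOpen_ball.mem_nhds
    (show a ∈ Metric.ball 0 (‖a‖ + 1) by simp))
  simp only [← sub_eq_add_neg] at h3
  exact h3

theorem continuous_qPochInf (h0 : 0 < q) (h1 : q < 1) : Continuous (qPochInf q) :=
  (differentiable_qPochInf h0 h1).continuous

theorem continuous_qPoch (q : ℝ) (n : ℕ) : Continuous fun a => qPoch q a n := by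
  unfold qPoch; fun_prop

/-- Each factor satisfies `|1 - xq^k| ≤ exp(ρq^k)`, and the exponents are summable. Uniformity in
both `x` and `n` is what the later dominations use. -/
theorem exists_norm_qPoch_le (h0 : 0 < q) (h1 : q < 1) (ρ : ℝ) :
    ∃ C : ℝ, 0 < C ∧ ∀ x : ℂ, ‖x‖ ≤ ρ → ∀ n, ‖qPoch q x n‖ ≤ C := by
  refine ⟨Real.exp (∑' k : ℕ, ρ * q ^ k), Real.exp_pos _, fun x hx n => ?_⟩
  have hρ : 0 ≤ ρ := (norm_nonneg x).trans hx
  have hs : Summable fun k : ℕ => ρ * q ^ k := (summable_geometric_of_lt_one h0.le h1).mul_left ρ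
  calc ‖qPoch q x n‖ = ∏ k ∈ Finset.range n, ‖1 - x * (q : ℂ) ^ k‖ := by rw [qPoch, norm_prod]
    _ ≤ ∏ k ∈ Finset.range n, Real.exp (ρ * q ^ k) := by
        refine Finset.prod_le_prod (fun _ _ => norm_nonneg _) fun k _ => ?_
        calc ‖1 - x * (q : ℂ) ^ k‖ ≤ ‖(1 : ℂ)‖ + ‖x * (q : ℂ) ^ k‖ := norm_sub_le _ _
          _ ≤ 1 + ρ * q ^ k := by
              rw [norm_one, norm_mul, norm_pow, Complex.norm_real, Real.norm_of_nonneg h0.le]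
              gcongr
          _ ≤ Real.exp (ρ * q ^ k) := by
              rw [add_comm]; exact Real.add_one_le_exp _
    _ = Real.exp (∑ k ∈ Finset.range n, ρ * q ^ k) := (Real.exp_sum _ _).symm
    _ ≤ _ := Real.exp_le_exp.2 (hs.sum_le_tsum _ fun k _ => by positivity)

/-- The reciprocals converge, because the infinite product is nonzero, and a convergent sequence is
bounded. -/
theorem exists_norm_inv_qPoch_le (h0 : 0 < q) (h1 : q < 1) {a : ℂ}
    (h : ∀ k : ℕ, a * (q : ℂ) ^ k ≠ 1) :
    ∃ C : ℝ, 0 < C ∧ ∀ n, ‖(qPoch q a n)⁻¹‖ ≤ C := by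
  have ht := ((tendsto_qPoch h0 h1 a).inv₀ (qPochInf_ne_zero h0 h1 h)).norm
  obtain ⟨C, hC⟩ := ht.bddAbove_range
  exact ⟨max C 1, by positivity, fun n => (hC ⟨n, rfl⟩).trans (le_max_left _ _)⟩

/-- Since `(aq^m;q)_n = (a;q)_{m+n} / (a;q)_m`, the two previous bounds give one that is independent
of the shift `m`. -/
theorem exists_norm_inv_qPoch_shift_le (h0 : 0 < q) (h1 : q < 1) {a : ℂ}
    (h : ∀ k : ℕ, a * (q : ℂ) ^ k ≠ 1) :
    ∃ C : ℝ, 0 < C ∧ ∀ m n, ‖(qPoch q (a * (q : ℂ) ^ m) n)⁻¹‖ ≤ C := by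
  obtain ⟨C, hC, hC'⟩ := exists_norm_inv_qPoch_le h0 h1 h
  obtain ⟨D, hD, hD'⟩ := exists_norm_qPoch_le h0 h1 ‖a‖
  refine ⟨D * C, by positivity, fun m n => ?_⟩
  have : (qPoch q (a * (q : ℂ) ^ m) n)⁻¹ = qPoch q a m * (qPoch q a (m + n))⁻¹ := by
    rw [qPoch_add, mul_inv, mul_inv_cancel_left₀ (qPoch_ne_zero h m)]
  rw [this, norm_mul]
  exact mul_le_mul (hD' a le_rfl m) (hC' _) (norm_nonneg _) hD.le

end QPochhammer

/-! ### The `q`-Gauss sum -/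

section QGauss

variable {q : ℝ}

/-- The terms of the `q`-Gauss series `₂φ₁(A, B; ABs; q, s)`. -/
noncomputable def qGaussTerm (q : ℝ) (A B s : ℂ) (m : ℕ) : ℂ :=
  qPoch q A m * qPoch q B m * s ^ m / (qPoch q q m * qPoch q (A * B * s) m)

theorem exists_norm_qGaussTerm_le (h0 : 0 < q) (h1 : q < 1) {A B s : ℂ}
    (hC : ∀ k : ℕ, A * B * s * (q : ℂ) ^ k ≠ 1) :
    ∃ C : ℝ, 0 < C ∧ ∀ n m, ‖qGaussTerm q A B (s * (q : ℂ) ^ n) m‖ ≤ C * ‖s‖ ^ m := by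
  obtain ⟨CA, hA, hA'⟩ := exists_norm_qPoch_le h0 h1 ‖A‖
  obtain ⟨CB, hB, hB'⟩ := exists_norm_qPoch_le h0 h1 ‖B‖
  obtain ⟨Cq, hq, hq'⟩ := exists_norm_inv_qPoch_le h0 h1
    (mul_pow_ne_one h0 h1 (norm_ofReal_lt_one h0 h1))
  obtain ⟨CD, hD, hD'⟩ := exists_norm_inv_qPoch_shift_le h0 h1 hC
  refine ⟨CA * CB * Cq * CD, by positivity, fun n m => ?_⟩
  have h2 : ‖s * (q : ℂ) ^ n‖ ≤ ‖s‖ := by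
    rw [norm_mul, norm_pow, Complex.norm_real, Real.norm_of_nonneg h0.le]
    exact mul_le_of_le_one_right (norm_nonneg _) (pow_le_one₀ h0.le h1.le)
  have h3 : qGaussTerm q A B (s * (q : ℂ) ^ n) m = qPoch q A m * qPoch q B m * (qPoch q q m)⁻¹ *
      (qPoch q (A * B * s * (q : ℂ) ^ n) m)⁻¹ * (s * (q : ℂ) ^ n) ^ m := by
    rw [qGaussTerm, ← mul_assoc (A * B), div_eq_mul_inv, mul_inv]; ring
  rw [h3, norm_mul, norm_mul, norm_mul, norm_mul, norm_pow]
  gcongr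
  · exact hA' A le_rfl m
  · exact hB' B le_rfl m
  · exact hq' m
  · exact hD' n m

theorem summable_qGaussTerm (h0 : 0 < q) (h1 : q < 1) {A B s : ℂ} (hs : ‖s‖ < 1)
    (hC : ∀ k : ℕ, A * B * s * (q : ℂ) ^ k ≠ 1) : Summable (qGaussTerm q A B s) := by
  obtain ⟨C, -, hC'⟩ := exists_norm_qGaussTerm_le h0 h1 hC
  refine Summable.of_norm_bounded
    ((summable_geometric_of_lt_one (norm_nonneg s) hs).mul_left C) fun m => ?_
  simpa using hC' 0 m

theorem shift_ne_one {c : ℂ} (hC : ∀ k : ℕ, c * (q : ℂ) ^ k ≠ 1) (n k : ℕ) :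
    c * (q : ℂ) ^ n * (q : ℂ) ^ k ≠ 1 := by
  rw [mul_assoc, ← pow_add]; exact hC _

/-- The contiguous relation behind the `q`-Gauss sum. -/
theorem tsum_qGaussTerm_contiguous (h0 : 0 < q) (h1 : q < 1) {A B s : ℂ} (hs : ‖s‖ < 1)
    (hC : ∀ k : ℕ, A * B * s * (q : ℂ) ^ k ≠ 1) :
    (1 - A * B * s) * (1 - s) * ∑' m, qGaussTerm q A B s m =
      (1 - A * s) * (1 - B * s) * ∑' m, qGaussTerm q A B (s * q) m := by
  have hs1 := summable_qGaussTerm h0 h1 hs hC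
  have hs2 : Summable (qGaussTerm q A B (s * q)) := by
    refine summable_qGaussTerm h0 h1 (by simpa using norm_mul_pow_lt_one h0 h1 hs 1) fun k => ?_
    simpa [← mul_assoc] using shift_ne_one hC 1 k
  -- `G` is the telescoping certificate: the factor `1 - q^m` gives `G 0 = 0`, and `G` tends to `0`
  -- along with the terms, so the differences sum to zero.
  set G : ℕ → ℂ := fun m => -(1 - A * B * s) * (1 - (q : ℂ) ^ m) * qGaussTerm q A B s m with hG
  have hG0 : Tendsto G atTop (𝓝 0) := by
    have h2 : Tendsto (fun m : ℕ => -(1 - A * B * s) * (1 - (q : ℂ) ^ m)) atTop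
        (𝓝 (-(1 - A * B * s) * (1 - 0))) := by
      refine (tendsto_const_nhds.sub ?_).const_mul _
      simpa using tendsto_mul_pow_zero h0 h1 1
    have h3 := h2.mul hs1.tendsto_atTop_zero
    rwa [mul_zero] at h3
  have hstep : ∀ m, (1 - A * B * s) * (1 - s) * qGaussTerm q A B s m -
      (1 - A * s) * (1 - B * s) * qGaussTerm q A B (s * q) m = G (m + 1) - G m := by
    intro m
    have e1 : qPoch q (A * B * (s * q)) m * (1 - A * B * s) =
        qPoch q (A * B * s) m * (1 - A * B * s * (q : ℂ) ^ m) := by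
      rw [← qPoch_succ, qPoch_succ', ← mul_assoc (A * B)]; ring
    have n1 : 1 - A * B * s ≠ 0 := sub_ne_zero.2 (by simpa using (hC 0).symm)
    have n2 : 1 - A * B * s * (q : ℂ) ^ m ≠ 0 := sub_ne_zero.2 (hC m).symm
    have n3 := qPoch_ne_zero hC m
    have n4 := qPoch_ne_zero_of_norm_lt h0 h1 (norm_ofReal_lt_one h0 h1) m
    have n5 : (1 : ℂ) - q * (q : ℂ) ^ m ≠ 0 :=
      sub_ne_zero.2 (mul_pow_ne_one h0 h1 (norm_ofReal_lt_one h0 h1) m).symm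
    have e2 : qPoch q (A * B * (s * q)) m =
        qPoch q (A * B * s) m * (1 - A * B * s * (q : ℂ) ^ m) / (1 - A * B * s) := by
      rw [← e1]; field_simp
    simp only [hG, qGaussTerm, e2, qPoch_succ, pow_succ, mul_pow]
    rw [mul_comm (q : ℂ)] at n5
    rw [mul_comm (q : ℂ) ((q : ℂ) ^ m)]
    generalize qPoch q A m = PA
    generalize qPoch q B m = PB
    generalize qPoch q (A * B * s) m = PC at *
    generalize qPoch q q m = PQ at *
    generalize hQ : (q : ℂ) ^ m = Q at *
    generalize s ^ m = S
    field_simp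
    ring
  have hsum : HasSum (fun m => (1 - A * B * s) * (1 - s) * qGaussTerm q A B s m -
      (1 - A * s) * (1 - B * s) * qGaussTerm q A B (s * q) m) 0 := by
    have hs3 := (hs1.mul_left ((1 - A * B * s) * (1 - s))).sub
      (hs2.mul_left ((1 - A * s) * (1 - B * s)))
    refine (hs3.hasSum_iff_tendsto_nat).2 ?_
    simp only [hstep, Finset.sum_range_sub]
    simpa [hG] using hG0
  have h3 := ((hs1.hasSum.mul_left ((1 - A * B * s) * (1 - s))).sub
      (hs2.hasSum.mul_left ((1 - A * s) * (1 - B * s)))).unique hsum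
  exact sub_eq_zero.1 h3

/-- The `q`-Gauss sum. -/
theorem tsum_qGaussTerm (h0 : 0 < q) (h1 : q < 1) {A B s : ℂ} (hs : ‖s‖ < 1)
    (hC : ∀ k : ℕ, A * B * s * (q : ℂ) ^ k ≠ 1) :
    ∑' m, qGaussTerm q A B s m =
      qPochInf q (A * s) * qPochInf q (B * s) / (qPochInf q (A * B * s) * qPochInf q s) := by
  have hiter : ∀ n : ℕ, qPoch q (A * B * s) n * qPoch q s n * ∑' m, qGaussTerm q A B s m =
      qPoch q (A * s) n * qPoch q (B * s) n *
        ∑' m, qGaussTerm q A B (s * (q : ℂ) ^ n) m := by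
    intro n
    induction n with
    | zero => simp [qPoch]
    | succ n ih =>
      have h2 := tsum_qGaussTerm_contiguous h0 h1 (A := A) (B := B)
        (norm_mul_pow_lt_one h0 h1 hs n) fun k => by
          simpa [← mul_assoc] using shift_ne_one hC n k
      simp only [qPoch_succ, pow_succ, ← mul_assoc] at h2 ⊢
      linear_combination (1 - A * B * s * (q : ℂ) ^ n) * (1 - s * (q : ℂ) ^ n) * ih +
        qPoch q (A * s) n * qPoch q (B * s) n * h2
  obtain ⟨C, -, hC'⟩ := exists_norm_qGaussTerm_le h0 h1 hC
  -- As `sq^n → 0` only the term `m = 0` survives. The domination needs denominator bounds uniform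
  -- in `n`, since the lower parameter `ABsq^n` moves as well.
  have hlim : Tendsto (fun n : ℕ => ∑' m, qGaussTerm q A B (s * (q : ℂ) ^ n) m) atTop
      (𝓝 (∑' m : ℕ, if m = 0 then 1 else 0)) := by
    refine tendsto_tsum_of_dominated_convergence
      ((summable_geometric_of_lt_one (norm_nonneg s) hs).mul_left C) (fun m => ?_)
      (Eventually.of_forall fun n m => hC' n m)
    have hz := tendsto_mul_pow_zero h0 h1 s
    have hd : qPoch q q m * qPoch q (A * B * 0) m ≠ 0 := by
      rw [mul_zero, qPoch_zero_left, mul_one]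
      exact qPoch_ne_zero_of_norm_lt h0 h1 (norm_ofReal_lt_one h0 h1) m
    have hc : ContinuousAt (fun z : ℂ => qGaussTerm q A B z m) 0 := by
      unfold qGaussTerm
      refine ContinuousAt.div (by fun_prop) ?_ hd
      exact (continuous_const.mul ((continuous_qPoch q m).comp (by fun_prop))).continuousAt
    have h2 := hc.tendsto.comp hz
    have h3 : qGaussTerm q A B 0 m = if m = 0 then 1 else 0 := by
      rcases Nat.eq_zero_or_pos m with rfl | hm
      · simp [qGaussTerm, qPoch]
      · simp [qGaussTerm, hm.ne']
    rw [h3] at h2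
    exact h2
  rw [tsum_ite_eq] at hlim
  have hL := ((tendsto_qPoch h0 h1 (A * B * s)).mul (tendsto_qPoch h0 h1 s)).mul_const
    (∑' m, qGaussTerm q A B s m)
  have hR := ((tendsto_qPoch h0 h1 (A * s)).mul (tendsto_qPoch h0 h1 (B * s))).mul hlim
  have := tendsto_nhds_unique hL (by simpa only [hiter] using hR)
  rw [eq_div_iff (mul_ne_zero (qPochInf_ne_zero h0 h1 hC) (qPochInf_ne_zero_of_norm_lt h0 h1 hs))]
  linear_combination this

end QGauss

/-! ### A Bailey pair by creative telescoping -/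

section BaileyPair

variable {q : ℝ}

/-- The first member of the Bailey pair relative to `α` obtained from the unit Bailey pair with
parameters `q / u` and `q / v`. -/
noncomputable def baileyAlpha (q : ℝ) (α u v : ℂ) (k : ℕ) : ℂ :=
  (1 - α * (q : ℂ) ^ (2 * k)) * (qPoch q α k * qPoch q (q / u) k * qPoch q (q / v) k) /
    ((1 - α) * (qPoch q q k * qPoch q (α * u) k * qPoch q (α * v) k)) *
    (-(α * u * v / q)) ^ k * (q : ℂ) ^ (k * (k - 1) / 2)

/-- The summands of the second member of the Bailey pair, indexed by `k` and `j = n - k`. -/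
noncomputable def baileyTerm (q : ℝ) (α u v : ℂ) (k j : ℕ) : ℂ :=
  baileyAlpha q α u v k / (qPoch q q j * qPoch q (α * q) (2 * k + j))

/-- The certificate of the recurrence for the sums of `baileyTerm`. -/
noncomputable def baileyCert (q : ℝ) (α u v : ℂ) (k j : ℕ) : ℂ :=
  -(baileyAlpha q α u v k * (q : ℂ) ^ j * (1 - (q : ℂ) ^ k) * (1 - α * u * (q : ℂ) ^ k / q) *
    (1 - α * v * (q : ℂ) ^ k / q) * (1 - α)) /
    ((1 - α * (q : ℂ) ^ (2 * k)) * (qPoch q q j * qPoch q α (2 * k + j)))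

theorem triangle_succ (k : ℕ) : (k + 1) * (k + 1 - 1) / 2 = k * (k - 1) / 2 + k := by
  rw [← Nat.choose_two_right, ← Nat.choose_two_right, Nat.choose_succ_left _ _ two_pos,
    show 2 - 1 = 1 from rfl, Nat.choose_one_right, add_comm]

/-- The ratio of consecutive terms is rational in `q^k`. The divisions by `u` and `v` in `q/u` and
`q/v` are absorbed by the power of `αuv/q`, leaving the factors `u - q^{k+1}` and `v - q^{k+1}`. -/
theorem baileyAlpha_succ (h0 : 0 < q) (h1 : q < 1) {α u v : ℂ} (hu : u ≠ 0) (hv : v ≠ 0)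
    (hα : ∀ k : ℕ, α * (q : ℂ) ^ k ≠ 1) (hαu : ∀ k : ℕ, α * u * (q : ℂ) ^ k ≠ 1)
    (hαv : ∀ k : ℕ, α * v * (q : ℂ) ^ k ≠ 1) (k : ℕ) :
    baileyAlpha q α u v (k + 1) = -(baileyAlpha q α u v k * (1 - α * (q : ℂ) ^ (2 * k + 2)) *
      (1 - α * (q : ℂ) ^ k) * (α / q) * (u - q * (q : ℂ) ^ k) * (v - q * (q : ℂ) ^ k) *
      (q : ℂ) ^ k) / ((1 - α * (q : ℂ) ^ (2 * k)) * (1 - q * (q : ℂ) ^ k) *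
      (1 - α * u * (q : ℂ) ^ k) * (1 - α * v * (q : ℂ) ^ k)) := by
  have hq : (q : ℂ) ≠ 0 := Complex.ofReal_ne_zero.2 h0.ne'
  have n0 : (1 : ℂ) - α ≠ 0 := sub_ne_zero.2 (by simpa using (hα 0).symm)
  have n1 := qPoch_ne_zero_of_norm_lt h0 h1 (norm_ofReal_lt_one h0 h1) k
  have n2 := qPoch_ne_zero hαu k
  have n3 := qPoch_ne_zero hαv k
  have n4 : (1 : ℂ) - α * (q : ℂ) ^ (2 * k) ≠ 0 := sub_ne_zero.2 (hα _).symm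
  have n5 : (1 : ℂ) - q * (q : ℂ) ^ k ≠ 0 :=
    sub_ne_zero.2 (mul_pow_ne_one h0 h1 (norm_ofReal_lt_one h0 h1) k).symm
  have n6 : (1 : ℂ) - α * u * (q : ℂ) ^ k ≠ 0 := sub_ne_zero.2 (hαu _).symm
  have n7 : (1 : ℂ) - α * v * (q : ℂ) ^ k ≠ 0 := sub_ne_zero.2 (hαv _).symm
  rw [baileyAlpha, baileyAlpha, triangle_succ]
  simp only [qPoch_succ, pow_succ (-(α * u * v / (q : ℂ))), pow_add, mul_add, mul_one, pow_mul]
  simp only [pow_mul] at n4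
  clear hα hαu hαv
  generalize qPoch q α k = PA
  generalize qPoch q (q / u) k = PB
  generalize qPoch q (q / v) k = PC
  generalize qPoch q q k = PQ at *
  generalize qPoch q (α * u) k = PU at *
  generalize qPoch q (α * v) k = PV at *
  generalize (-(α * u * v / (q : ℂ))) ^ k = E
  generalize (q : ℂ) ^ (k * (k - 1) / 2) = F
  rw [pow_right_comm] at n4 ⊢
  generalize (q : ℂ) ^ k = K at *
  have eu : 1 - (q : ℂ) / u * K = (u - q * K) / u := by field_simp
  have ev : 1 - (q : ℂ) / v * K = (v - q * K) / v := by field_simp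
  rw [eu, ev]
  generalize 1 - α * K ^ 2 = d4 at *
  generalize 1 - (q : ℂ) * K = d5 at *
  generalize 1 - α * u * K = d6 at *
  generalize 1 - α * v * K = d7 at *
  generalize 1 - α = d0 at *
  generalize 1 - α * K = d1
  generalize (u - q * K) = x
  generalize (v - q * K) = y
  generalize 1 - α * (K ^ 2 * (q : ℂ) ^ 2) = d2
  have e1 : x / u * (y / v) * (α * u * v / q) = α / q * x * y := by field_simp
  calc _ = -(d2 * d1 * (PA * PB * PC) / (d0 * (PQ * PU * PV)) * E * F * K *
        (x / u * (y / v) * (α * u * v / q)) / (d5 * d6 * d7)) := by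
          simp only [div_eq_mul_inv, mul_inv]; ring
    _ = _ := by
      rw [e1, mul_assoc d4 d5 d6, mul_assoc d4 (d5 * d6) d7]
      rw [neg_div, neg_inj, div_eq_div_iff (mul_ne_zero (mul_ne_zero n5 n6) n7)
        (mul_ne_zero n4 (mul_ne_zero (mul_ne_zero n5 n6) n7))]
      simp only [div_eq_mul_inv, mul_inv]; ring

/-- With `n = k + j` this is a first-order recurrence operator in `n` applied to the summand,
written as a difference in `k` at fixed `n`. Once `baileyAlpha_succ` is inserted, all shifted
factorials cancel and a rational identity in `q^k` and `q^j` remains. -/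
theorem bailey_step (h0 : 0 < q) (h1 : q < 1) {α u v : ℂ} (hu : u ≠ 0) (hv : v ≠ 0)
    (hα : ∀ k : ℕ, α * (q : ℂ) ^ k ≠ 1) (hαu : ∀ k : ℕ, α * u * (q : ℂ) ^ k ≠ 1)
    (hαv : ∀ k : ℕ, α * v * (q : ℂ) ^ k ≠ 1) (k j : ℕ) :
    (1 - q * (q : ℂ) ^ (k + j)) * (1 - α * u * (q : ℂ) ^ (k + j)) *
        (1 - α * v * (q : ℂ) ^ (k + j)) * baileyTerm q α u v k (j + 1) -
      (1 - α * u * v / q * (q : ℂ) ^ (k + j)) * baileyTerm q α u v k j =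
    baileyCert q α u v (k + 1) j - baileyCert q α u v k (j + 1) := by
  have hq : (q : ℂ) ≠ 0 := Complex.ofReal_ne_zero.2 h0.ne'
  have n0 : (1 : ℂ) - α ≠ 0 := sub_ne_zero.2 (by simpa using (hα 0).symm)
  have n1 := qPoch_ne_zero_of_norm_lt h0 h1 (norm_ofReal_lt_one h0 h1) j
  have n2 := qPoch_ne_zero hα (2 * k + j)
  have n4 : (1 : ℂ) - α * (q : ℂ) ^ (2 * k) ≠ 0 := sub_ne_zero.2 (hα _).symm
  have n4' : (1 : ℂ) - α * (q : ℂ) ^ (2 * (k + 1)) ≠ 0 := sub_ne_zero.2 (hα _).symm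
  have n5 : (1 : ℂ) - q * (q : ℂ) ^ k ≠ 0 :=
    sub_ne_zero.2 (mul_pow_ne_one h0 h1 (norm_ofReal_lt_one h0 h1) k).symm
  have n5' : (1 : ℂ) - q * (q : ℂ) ^ j ≠ 0 :=
    sub_ne_zero.2 (mul_pow_ne_one h0 h1 (norm_ofReal_lt_one h0 h1) j).symm
  have n6 : (1 : ℂ) - α * u * (q : ℂ) ^ k ≠ 0 := sub_ne_zero.2 (hαu _).symm
  have n7 : (1 : ℂ) - α * v * (q : ℂ) ^ k ≠ 0 := sub_ne_zero.2 (hαv _).symm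
  have n8 : (1 : ℂ) - α * (q : ℂ) ^ (2 * k + j) ≠ 0 := sub_ne_zero.2 (hα _).symm
  have n9 : (1 : ℂ) - α * (q : ℂ) ^ (2 * k + j + 1) ≠ 0 := sub_ne_zero.2 (hα _).symm
  have e1 : ∀ m, qPoch q (α * q) m = qPoch q α (m + 1) / (1 - α) := fun m => by
    rw [qPoch_succ']; field_simp
  have e2 : 2 * (k + 1) + j = 2 * k + j + 1 + 1 := by ring
  simp only [baileyTerm, baileyCert, baileyAlpha_succ h0 h1 hu hv hα hαu hαv, e1, e2, qPoch_succ,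
    ← add_assoc] at *
  simp only [pow_add, pow_mul, pow_one, mul_add, mul_one] at *
  generalize qPoch q α (2 * k + j) = PA at *
  generalize qPoch q q j = PQ at *
  generalize baileyAlpha q α u v k = W
  simp only [pow_right_comm (q : ℂ) 2 k] at *
  generalize (q : ℂ) ^ k = K at *
  generalize (q : ℂ) ^ j = J at *
  generalize hd0 : 1 - α = d0 at *
  generalize hd4 : 1 - α * K ^ 2 = d4 at *
  generalize hd4' : 1 - α * (K ^ 2 * (q : ℂ) ^ 2) = d4' at *
  generalize hd5 : 1 - (q : ℂ) * K = d5 at *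
  generalize hd5' : 1 - (q : ℂ) * J = d5' at *
  generalize hd6 : 1 - α * u * K = d6 at *
  generalize hd7 : 1 - α * v * K = d7 at *
  generalize hd8 : 1 - α * (K ^ 2 * J) = d8 at *
  generalize hd9 : 1 - α * (K ^ 2 * J * q) = d9 at *
  field_simp
  subst hd0 hd4 hd4' hd5 hd5' hd6 hd7 hd8 hd9
  ring

/-- This is a terminating very-well-poised `₆φ₅` sum. Summing `bailey_step` over `k` gives a
first-order recurrence in `n`, which the closed form also satisfies. -/
theorem sum_baileyTerm (h0 : 0 < q) (h1 : q < 1) {α u v : ℂ} (hu : u ≠ 0) (hv : v ≠ 0)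
    (hα : ∀ k : ℕ, α * (q : ℂ) ^ k ≠ 1) (hαu : ∀ k : ℕ, α * u * (q : ℂ) ^ k ≠ 1)
    (hαv : ∀ k : ℕ, α * v * (q : ℂ) ^ k ≠ 1) (n : ℕ) :
    ∑ k ∈ Finset.range (n + 1), baileyTerm q α u v k (n - k) =
      qPoch q (α * u * v / q) n / (qPoch q q n * (qPoch q (α * u) n * qPoch q (α * v) n)) := by
  have n0 : (1 : ℂ) - α ≠ 0 := sub_ne_zero.2 (by simpa using (hα 0).symm)
  induction n with
  | zero => simp [baileyTerm, baileyAlpha, qPoch, n0]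
  | succ n ih =>
    have n1 := qPoch_ne_zero_of_norm_lt h0 h1 (norm_ofReal_lt_one h0 h1) n
    have n2 := qPoch_ne_zero hαu n
    have n3 := qPoch_ne_zero hαv n
    have n5 : (1 : ℂ) - q * (q : ℂ) ^ n ≠ 0 :=
      sub_ne_zero.2 (mul_pow_ne_one h0 h1 (norm_ofReal_lt_one h0 h1) n).symm
    have n6 : (1 : ℂ) - α * u * (q : ℂ) ^ n ≠ 0 := sub_ne_zero.2 (hαu _).symm
    have n7 : (1 : ℂ) - α * v * (q : ℂ) ^ n ≠ 0 := sub_ne_zero.2 (hαv _).symm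
    -- The lower boundary term vanishes through the factor `1 - q^k` of the certificate at `k = 0`.
    have htel : ∀ m ≤ n + 1, ∑ k ∈ Finset.range m,
        ((1 - q * (q : ℂ) ^ n) * (1 - α * u * (q : ℂ) ^ n) * (1 - α * v * (q : ℂ) ^ n) *
          baileyTerm q α u v k (n + 1 - k) -
        (1 - α * u * v / q * (q : ℂ) ^ n) * baileyTerm q α u v k (n - k)) =
        baileyCert q α u v m (n + 1 - m) := by
      intro m
      induction m with
      | zero => intro _; simp [baileyCert]
      | succ m ihm =>
        intro hm
        obtain ⟨j, rfl⟩ := Nat.exists_eq_add_of_le (Nat.le_of_succ_le_succ hm)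
        have h := bailey_step h0 h1 hu hv hα hαu hαv m j
        rw [Finset.sum_range_succ, ihm (by omega), show m + j + 1 - m = j + 1 by omega,
          show m + j - m = j by omega, show m + j + 1 - (m + 1) = j by omega]
        linear_combination h
    -- The sum for `n + 1` has one term, `k = n + 1`, with no partner in the sum for `n`; it cancels
    -- the upper boundary value of the certificate.
    have hlast : (1 - q * (q : ℂ) ^ n) * (1 - α * u * (q : ℂ) ^ n) * (1 - α * v * (q : ℂ) ^ n) *
        baileyTerm q α u v (n + 1) 0 = -baileyCert q α u v (n + 1) 0 := by
      have hq : (q : ℂ) ≠ 0 := Complex.ofReal_ne_zero.2 h0.ne'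
      have n8 := qPoch_ne_zero hα (2 * (n + 1))
      have n9 : (1 : ℂ) - α * (q : ℂ) ^ (2 * (n + 1)) ≠ 0 := sub_ne_zero.2 (hα _).symm
      have e1 : qPoch q (α * q) (2 * (n + 1)) = qPoch q α (2 * (n + 1)) *
          (1 - α * (q : ℂ) ^ (2 * (n + 1))) / (1 - α) := by
        rw [← qPoch_succ, qPoch_succ']; field_simp
      rw [baileyTerm, baileyCert, add_zero, e1, qPoch_zero_right, pow_succ]
      field_simp
    have h := htel (n + 1) le_rfl
    rw [Finset.sum_sub_distrib, ← Finset.mul_sum, ← Finset.mul_sum, ih, Nat.sub_self] at h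
    rw [Finset.sum_range_succ, Nat.sub_self]
    have hX := mul_ne_zero (mul_ne_zero n5 n6) n7
    apply mul_left_cancel₀ hX
    rw [mul_add, hlast, ← h]
    simp only [qPoch_succ]
    generalize 1 - (q : ℂ) * (q : ℂ) ^ n = d5 at *
    generalize 1 - α * u * (q : ℂ) ^ n = d6 at *
    generalize 1 - α * v * (q : ℂ) ^ n = d7 at *
    generalize α * u * v / (q : ℂ) = e at *
    field_simp
    ring

end BaileyPair

/-! ### Expansion of a `₃φ₂` in a very-well-poised series -/

section WatsonLimit

variable {q : ℝ}

theorem summable_pow_mul_triangle (h0 : 0 < q) (h1 : q < 1) {M : ℝ} (hM : 0 < M) :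
    Summable fun k : ℕ => M ^ k * q ^ (k * (k - 1) / 2) := by
  refine summable_of_ratio_test_tendsto_lt_one zero_lt_one
    (Eventually.of_forall fun k => by positivity) ?_
  have h : Tendsto (fun k : ℕ => M * q ^ k) atTop (𝓝 0) := by
    simpa using (tendsto_pow_atTop_nhds_zero_of_lt_one h0.le h1).const_mul M
  refine h.congr fun k => ?_
  rw [Real.norm_of_nonneg (by positivity), Real.norm_of_nonneg (by positivity), triangle_succ,
    pow_add, pow_succ]
  field_simp
  ring

theorem summable_norm_baileyAlpha (h0 : 0 < q) (h1 : q < 1) (α u v : ℂ)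
    (hαu : ∀ k : ℕ, α * u * (q : ℂ) ^ k ≠ 1) (hαv : ∀ k : ℕ, α * v * (q : ℂ) ^ k ≠ 1) :
    Summable fun k => ‖baileyAlpha q α u v k‖ := by
  obtain ⟨C1, p1, b1⟩ := exists_norm_qPoch_le h0 h1 ‖α‖
  obtain ⟨C2, p2, b2⟩ := exists_norm_qPoch_le h0 h1 ‖(q : ℂ) / u‖
  obtain ⟨C3, p3, b3⟩ := exists_norm_qPoch_le h0 h1 ‖(q : ℂ) / v‖
  obtain ⟨C4, p4, b4⟩ := exists_norm_inv_qPoch_le h0 h1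
    (mul_pow_ne_one h0 h1 (norm_ofReal_lt_one h0 h1))
  obtain ⟨C5, p5, b5⟩ := exists_norm_inv_qPoch_le h0 h1 hαu
  obtain ⟨C6, p6, b6⟩ := exists_norm_inv_qPoch_le h0 h1 hαv
  -- The added `1` keeps `M` positive even when `α = 0`, as the ratio test requires.
  set M := ‖α * u * v / q‖ + 1 with hM
  have pM : 0 < M := by positivity
  refine Summable.of_nonneg_of_le (fun _ => norm_nonneg _) (fun k => ?_)
    ((summable_pow_mul_triangle h0 h1 pM).mul_left
      ((1 + ‖α‖) * (C1 * C2 * C3) * (‖(1 - α)⁻¹‖ * (C4 * C5 * C6))))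
  rw [baileyAlpha, div_eq_mul_inv, mul_inv, mul_inv, mul_inv, ← mul_assoc _ (M ^ k)]
  simp only [norm_mul]
  have e1 : ‖(q : ℂ) ^ (k * (k - 1) / 2)‖ = q ^ (k * (k - 1) / 2) := by
    rw [norm_pow, Complex.norm_real, Real.norm_of_nonneg h0.le]
  have e2 : ‖(-(α * u * v / (q : ℂ))) ^ k‖ ≤ M ^ k := by
    rw [norm_pow, norm_neg]
    gcongr
    linarith
  have e3 : ‖1 - α * (q : ℂ) ^ (2 * k)‖ ≤ 1 + ‖α‖ := by
    refine (norm_sub_le _ _).trans ?_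
    rw [norm_one, norm_mul, norm_pow, Complex.norm_real, Real.norm_of_nonneg h0.le]
    gcongr
    exact mul_le_of_le_one_right (norm_nonneg _) (pow_le_one₀ h0.le h1.le)
  rw [e1]
  gcongr
  · exact b1 _ le_rfl k
  · exact b2 _ le_rfl k
  · exact b3 _ le_rfl k
  · exact b4 k
  · exact b5 k
  · exact b6 k

/-- Absolute convergence allows the double series to be summed along its finite antidiagonals. -/
theorem tsum_sum_range_sub {f : ℕ → ℕ → ℂ} (hf : Summable fun p : ℕ × ℕ => f p.1 p.2) :
    ∑' n, ∑ k ∈ Finset.range (n + 1), f k (n - k) = ∑' k, ∑' j, f k j := by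
  have h := Summable.tsum_sigma' (fun n => (hasSum_fintype _).summable)
    (Finset.HasAntidiagonal.sigmaAntidiagonalEquivProd.summable_iff.2 hf)
  rw [← hf.tsum_prod]
  refine Eq.trans ?_ (h.symm.trans (Finset.HasAntidiagonal.sigmaAntidiagonalEquivProd.tsum_eq
    (fun p : ℕ × ℕ => f p.1 p.2)))
  refine tsum_congr fun n => ?_
  rw [tsum_fintype, ← Finset.Nat.sum_antidiagonal_eq_sum_range_succ f n]
  exact (Finset.sum_coe_sort (Finset.HasAntidiagonal.antidiagonal n)
    (fun p => f p.1 p.2)).symm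

/-- The limiting case of Watson's `q`-Whipple transformation in which a `₃φ₂` series is expanded
in a very-well-poised series. -/
theorem tsum_watson_limit (h0 : 0 < q) (h1 : q < 1) {α u v x y s : ℂ} (hu : u ≠ 0) (hv : v ≠ 0)
    (hα : ∀ k : ℕ, α * (q : ℂ) ^ k ≠ 1) (hαu : ∀ k : ℕ, α * u * (q : ℂ) ^ k ≠ 1)
    (hαv : ∀ k : ℕ, α * v * (q : ℂ) ^ k ≠ 1) (hs : ‖s‖ < 1) (hxys : x * y * s = α * q) :
    ∑' n, qPoch q x n * qPoch q y n * qPoch q (α * u * v / q) n * s ^ n /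
        (qPoch q q n * (qPoch q (α * u) n * qPoch q (α * v) n)) =
      ∑' k, baileyAlpha q α u v k * s ^ k * (qPoch q x k * qPoch q y k *
        (qPochInf q (x * s * (q : ℂ) ^ k) * qPochInf q (y * s * (q : ℂ) ^ k))) /
          (qPochInf q (α * q) * qPochInf q s) := by
  have hαq : ∀ k : ℕ, α * q * (q : ℂ) ^ k ≠ 1 := fun k => by
    simpa [pow_succ, mul_assoc, mul_comm, mul_left_comm] using hα (k + 1)
  set f : ℕ → ℕ → ℂ := fun k j => qPoch q x (k + j) * qPoch q y (k + j) * s ^ (k + j) *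
    baileyTerm q α u v k j with hf
  have hsum : Summable fun p : ℕ × ℕ => f p.1 p.2 := by
    obtain ⟨C1, p1, b1⟩ := exists_norm_qPoch_le h0 h1 ‖x‖
    obtain ⟨C2, p2, b2⟩ := exists_norm_qPoch_le h0 h1 ‖y‖
    obtain ⟨C3, p3, b3⟩ := exists_norm_inv_qPoch_le h0 h1
      (mul_pow_ne_one h0 h1 (norm_ofReal_lt_one h0 h1))
    obtain ⟨C4, p4, b4⟩ := exists_norm_inv_qPoch_le h0 h1 hαq
    refine Summable.of_norm_bounded ((((summable_norm_baileyAlpha h0 h1 α u v hαu hαv).mul_of_nonneg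
      (summable_geometric_of_lt_one (norm_nonneg s) hs) (fun _ => norm_nonneg _)
      (fun _ => by positivity))).mul_left (C1 * C2 * C3 * C4)) fun p => ?_
    have e : f p.1 p.2 = qPoch q x (p.1 + p.2) * qPoch q y (p.1 + p.2) * (qPoch q q p.2)⁻¹ *
        (qPoch q (α * q) (2 * p.1 + p.2))⁻¹ * (baileyAlpha q α u v p.1 * s ^ p.2) * s ^ p.1 := by
      simp only [hf, baileyTerm, div_eq_mul_inv, mul_inv, pow_add]; ring
    rw [e]
    simp only [norm_mul, norm_pow]
    refine (mul_le_of_le_one_right (by positivity) (pow_le_one₀ (norm_nonneg _) hs.le)).trans ?_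
    gcongr
    · exact b1 _ le_rfl _
    · exact b2 _ le_rfl _
    · exact b3 _
    · exact b4 _
  calc _ = ∑' n, ∑ k ∈ Finset.range (n + 1), f k (n - k) := by
        refine tsum_congr fun n => ?_
        have e : ∀ k ∈ Finset.range (n + 1), f k (n - k) =
            qPoch q x n * qPoch q y n * s ^ n * baileyTerm q α u v k (n - k) := fun k hk => by
          simp only [hf]
          rw [Nat.add_sub_cancel' (Nat.le_of_lt_succ (Finset.mem_range.1 hk))]
        rw [Finset.sum_congr rfl e, ← Finset.mul_sum, sum_baileyTerm h0 h1 hu hv hα hαu hαv]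
        ring
    _ = ∑' k, ∑' j, f k j := tsum_sum_range_sub hsum
    _ = _ := by
        refine tsum_congr fun k => ?_
        -- This is where `xys = αq` enters: splitting `(αq;q)_{2k+j}` at `2k` leaves precisely the
        -- lower parameter that makes the inner series summable by `q`-Gauss.
        have e0 : x * (q : ℂ) ^ k * (y * (q : ℂ) ^ k) * s = α * q * (q : ℂ) ^ (2 * k) := by
          rw [← hxys]; ring
        have e1 : ∀ j, f k j = baileyAlpha q α u v k * s ^ k * (qPoch q x k * qPoch q y k) /
            qPoch q (α * q) (2 * k) *
              qGaussTerm q (x * (q : ℂ) ^ k) (y * (q : ℂ) ^ k) s j := fun j => by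
          simp only [hf, baileyTerm, qGaussTerm, e0, qPoch_add, pow_add, div_eq_mul_inv, mul_inv]
          ring
        have n1 := qPochInf_ne_zero h0 h1 hαq
        have e2 := qPochInf_eq_mul h0 h1 (α * q) (2 * k)
        rw [tsum_congr e1, tsum_mul_left, tsum_qGaussTerm h0 h1 hs
          (by rw [e0]; exact shift_ne_one hαq _), e0, e2, mul_right_comm x, mul_right_comm y]
        simp only [div_eq_mul_inv, mul_inv]
        ring

end WatsonLimit

/-! ### Rahman's `q`-beta integral on the unit circle -/

section RahmanIntegral

variable {q : ℝ}

/-- The product `(tz, t/z; q)_∞`. -/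
noncomputable def qPochPair (q : ℝ) (t z : ℂ) : ℂ := qPochInf q (t * z) * qPochInf q (t * z⁻¹)

/-- The integrand of Rahman's `q`-beta integral on the unit circle. -/
noncomputable def rahmanKernel (q : ℝ) (a b c d e z : ℂ) : ℂ :=
  qPochInf q (z ^ 2) * qPochInf q (z⁻¹ ^ 2) * qPochPair q (a * b * c * d * e) z /
    (qPochPair q a z * qPochPair q b z * qPochPair q c z * qPochPair q d z * qPochPair q e z)

/-- The function whose shift by `q` produces the contiguous relation for Rahman's integral. -/
noncomputable def rahmanAux (q : ℝ) (a b c d e z : ℂ) : ℂ :=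
  z * qPochInf q (z ^ 2) * qPochInf q (q * z⁻¹ ^ 2) *
    (qPochInf q (a * b * c * d * e * z) * qPochInf q (q * (a * b * c * d * e) * z⁻¹)) /
    ((qPochInf q (a * z) * qPochInf q (q * a * z⁻¹)) *
      (qPochInf q (b * z) * qPochInf q (q * b * z⁻¹)) *
      (qPochInf q (c * z) * qPochInf q (q * c * z⁻¹)) *
      (qPochInf q (d * z) * qPochInf q (q * d * z⁻¹)) *
      (qPochInf q (e * z) * qPochInf q (q * e * z⁻¹)))

theorem qPochPair_ne_zero (h0 : 0 < q) (h1 : q < 1) {t z : ℂ} (ht : ‖t‖ < 1) (hz : ‖z‖ = 1) :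
    qPochPair q t z ≠ 0 :=
  mul_ne_zero (qPochInf_ne_zero_of_norm_lt h0 h1 (by rwa [norm_mul, hz, mul_one]))
    (qPochInf_ne_zero_of_norm_lt h0 h1 (by rwa [norm_mul, norm_inv, hz, inv_one, mul_one]))

theorem rahmanAux_mul (h0 : 0 < q) (h1 : q < 1) (a b c d e : ℂ) {z : ℂ} (hz : z ≠ 0) :
    rahmanAux q a b c d e (q * z) = -rahmanAux q a b c d e z⁻¹ := by
  have hq : (q : ℂ) ≠ 0 := Complex.ofReal_ne_zero.2 h0.ne'
  have e1 : ∀ t : ℂ, (q : ℂ) * t * (q * z)⁻¹ = t * z⁻¹ := fun t => by field_simp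
  have e2 : ∀ t : ℂ, t * (q * z) = q * t * z := fun t => by ring
  have e3 : (q : ℂ) * (q * z)⁻¹ ^ 2 = z⁻¹ ^ 2 * (q : ℂ)⁻¹ := by field_simp
  have e4 : qPochInf q (z⁻¹ ^ 2 * (q : ℂ)⁻¹) =
      (1 - z⁻¹ ^ 2 * (q : ℂ)⁻¹) * qPochInf q (z⁻¹ ^ 2) := by
    rw [qPochInf_eq_one_sub_mul h0 h1, inv_mul_cancel_right₀ hq]
  have e5 : qPochInf q (q * z ^ 2) = (1 - q * z ^ 2) * qPochInf q ((q * z) ^ 2) := by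
    rw [qPochInf_eq_one_sub_mul h0 h1]; congr 2; ring
  -- The minus sign of the functional equation arises here; the remaining products are merely
  -- interchanged by `z → 1/(qz)`.
  have e6 : q * z * (1 - z⁻¹ ^ 2 * (q : ℂ)⁻¹) = -(z⁻¹ * (1 - q * z ^ 2)) := by
    field_simp; ring
  simp only [rahmanAux, e1, e2, e3, e4, e5, inv_inv]
  rw [← neg_div]
  congr 1
  · linear_combination (qPochInf q ((q * z) ^ 2) * qPochInf q (z⁻¹ ^ 2) *
      (qPochInf q (q * (a * b * c * d * e) * z) * qPochInf q (a * b * c * d * e * z⁻¹))) * e6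
  · ring

/-- The denominators contain `tz` and `qt/z`, both of modulus less than `1` on the closed annulus
when `|t| < 1`, so no pole lies there. -/
theorem differentiableAt_rahmanAux (h0 : 0 < q) (h1 : q < 1) {a b c d e z : ℂ}
    (ha : ‖a‖ < 1) (hb : ‖b‖ < 1) (hc : ‖c‖ < 1) (hd : ‖d‖ < 1) (he : ‖e‖ < 1)
    (hz : q ≤ ‖z‖) (hz1 : ‖z‖ ≤ 1) : DifferentiableAt ℂ (rahmanAux q a b c d e) z := by
  have hz0 : z ≠ 0 := norm_pos_iff.1 (h0.trans_le hz)
  have hD : ∀ f : ℂ → ℂ, DifferentiableAt ℂ f z → DifferentiableAt ℂ (fun x => qPochInf q (f x)) z :=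
    fun f hf => (differentiable_qPochInf h0 h1 (f z)).comp z hf
  have n1 : ∀ t : ℂ, ‖t‖ < 1 → qPochInf q (t * z) * qPochInf q (q * t * z⁻¹) ≠ 0 := by
    intro t ht
    refine mul_ne_zero (qPochInf_ne_zero_of_norm_lt h0 h1 ?_)
      (qPochInf_ne_zero_of_norm_lt h0 h1 ?_)
    · rw [norm_mul]; exact (mul_le_of_le_one_right (norm_nonneg _) hz1).trans_lt ht
    · rw [norm_mul, norm_mul, norm_inv, Complex.norm_real, Real.norm_of_nonneg h0.le,
        mul_right_comm]
      refine (mul_le_of_le_one_left (norm_nonneg _) ?_).trans_lt ht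
      rw [← div_eq_mul_inv]
      exact (div_le_one (h0.trans_le hz)).2 hz
  have hi : DifferentiableAt ℂ (fun x : ℂ => x⁻¹) z := differentiableAt_inv hz0
  have hp : ∀ t : ℂ, DifferentiableAt ℂ
      (fun x => qPochInf q (t * x) * qPochInf q (q * t * x⁻¹)) z := fun t =>
    (hD _ (by fun_prop)).mul (hD _ (hi.const_mul _))
  refine DifferentiableAt.div ?_ ?_ ?_
  · exact ((differentiableAt_id.mul (hD _ (by fun_prop))).mul
      (hD _ ((hi.pow 2).const_mul _))).mul (hp _)
  · exact ((((hp a).mul (hp b)).mul (hp c)).mul (hp d)).mul (hp e)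
  · exact mul_ne_zero (mul_ne_zero (mul_ne_zero (mul_ne_zero (n1 a ha) (n1 b hb)) (n1 c hc))
      (n1 d hd)) (n1 e he)

/-- Cauchy's theorem on the annulus moves the circle from radius `1` to radius `q`, where
`rahmanAux_mul` turns the average into minus itself after `z → 1/z`. -/
theorem circleAverage_rahmanAux (h0 : 0 < q) (h1 : q < 1) {a b c d e : ℂ}
    (ha : ‖a‖ < 1) (hb : ‖b‖ < 1) (hc : ‖c‖ < 1) (hd : ‖d‖ < 1) (he : ‖e‖ < 1) :
    Real.circleAverage (rahmanAux q a b c d e) 0 1 = 0 := by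
  have hdiff : ∀ z : ℂ, q ≤ ‖z‖ → ‖z‖ ≤ 1 → DifferentiableAt ℂ (rahmanAux q a b c d e) z :=
    fun z => differentiableAt_rahmanAux h0 h1 ha hb hc hd he
  have hA := Complex.circleIntegral_sub_center_inv_smul_eq_of_differentiable_on_annulus_off_countable
    (c := 0) h0 h1.le (f := rahmanAux q a b c d e) Set.countable_empty
    (fun z hz => (hdiff z (by simpa using hz.2) (by simpa using hz.1)).continuousAt.continuousWithinAt)
    (fun z hz => hdiff z (by simpa using (not_le.1 (by simpa using hz.1.2)).le)
      (by simpa using (mem_ball_zero_iff.1 hz.1.1).le))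
  have h2 : Real.circleAverage (rahmanAux q a b c d e) 0 1 =
      Real.circleAverage (rahmanAux q a b c d e) 0 q := by
    rw [Real.circleAverage_eq_circleIntegral one_ne_zero,
      Real.circleAverage_eq_circleIntegral h0.ne', hA]
  have h3 : Real.circleAverage (rahmanAux q a b c d e) 0 q =
      Real.circleAverage (-fun z => rahmanAux q a b c d e z⁻¹) 0 1 := by
    rw [Real.circleAverage_eq_circleAverage_zero_one]
    refine Real.circleAverage_congr_sphere fun z hz => ?_
    have hz0 : z ≠ 0 := by
      rintro rfl; simp at hz
    simpa using rahmanAux_mul h0 h1 a b c d e hz0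
  have h4 : Real.circleAverage (-fun z => rahmanAux q a b c d e z⁻¹) 0 1 =
      -Real.circleAverage (fun z => rahmanAux q a b c d e z⁻¹) 0 1 := by
    rw [Real.circleAverage_def, Real.circleAverage_def]
    simp
  rw [Real.circleAverage_zero_one_congr_inv] at h4
  have h5 := h2.trans (h3.trans h4)
  linear_combination (1 / 2 : ℂ) * h5

/-- Splitting the first factor off each infinite product whose argument lacks a `q` reduces all four
functions to the same infinite products, so only a rational identity is left. -/
theorem rahmanKernel_contiguous (h0 : 0 < q) (h1 : q < 1) {a b c d e z : ℂ}
    (ha : ‖a‖ < 1) (hb : ‖b‖ < 1) (hc : ‖c‖ < 1) (hd : ‖d‖ < 1) (he : ‖e‖ < 1) (hz : ‖z‖ = 1) :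
    (1 - a * b) * (1 - a * c) * (1 - a * d) * (1 - a * e) * rahmanKernel q a b c d e z -
      (1 - a * c * d * e) * (1 - a * b * d * e) * (1 - a * b * c * e) * (1 - a * b * c * d) *
        rahmanKernel q (a * q) b c d e z =
    a * (1 - a * (a * b * c * d * e)) *
      (rahmanAux q a b c d e z + rahmanAux q a b c d e z⁻¹) := by
  have hz0 : z ≠ 0 := norm_pos_iff.1 (by rw [hz]; exact one_pos)
  have hw : ‖z⁻¹‖ = 1 := by rw [norm_inv, hz, inv_one]
  have n1 : ∀ t x : ℂ, ‖t‖ < 1 → ‖x‖ = 1 → qPochInf q (t * x) ≠ 0 := fun t x ht hx =>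
    qPochInf_ne_zero_of_norm_lt h0 h1 (by rwa [norm_mul, hx, mul_one])
  have n2 : ∀ t x : ℂ, ‖t‖ < 1 → ‖x‖ = 1 → qPochInf q (q * t * x) ≠ 0 := fun t x ht hx =>
    qPochInf_ne_zero_of_norm_lt h0 h1 (by
      rw [norm_mul, hx, mul_one, mul_comm]
      simpa using norm_mul_pow_lt_one h0 h1 ht 1)
  have n3 : ∀ t x : ℂ, ‖t‖ < 1 → ‖x‖ = 1 → 1 - t * x ≠ 0 := fun t x ht hx h => by
    have h3 := congrArg norm (sub_eq_zero.1 h)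
    rw [norm_one, norm_mul, hx, mul_one] at h3
    exact ht.ne h3.symm
  have e1 : ∀ t x : ℂ, qPochInf q (t * x) = (1 - t * x) * qPochInf q (q * t * x) := fun t x => by
    rw [qPochInf_eq_one_sub_mul h0 h1]; congr 2; ring
  have e2 : ∀ x : ℂ, qPochInf q (x ^ 2) = (1 - x ^ 2) * qPochInf q (q * x ^ 2) := fun x => by
    rw [qPochInf_eq_one_sub_mul h0 h1, mul_comm (x ^ 2)]
  have e3 : ∀ x : ℂ, qPochInf q (a * q * x) = qPochInf q (q * a * x) := fun x => by
    rw [mul_comm a]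
  have e4 : ∀ x : ℂ, qPochInf q (a * q * b * c * d * e * x) =
      qPochInf q (q * (a * b * c * d * e) * x) := fun x => by
    congr 1; ring
  simp only [rahmanKernel, rahmanAux, qPochPair, inv_inv, e3, e4]
  simp only [e1 a, e1 b, e1 c, e1 d, e1 e, e1 (a * b * c * d * e), e2]
  have a1 := n2 a z ha hz
  have a2 := n2 a z⁻¹ ha hw
  have b1 := n2 b z hb hz
  have b2 := n2 b z⁻¹ hb hw
  have c1 := n2 c z hc hz
  have c2 := n2 c z⁻¹ hc hw
  have d1 := n2 d z hd hz
  have d2 := n2 d z⁻¹ hd hw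
  have i1 := n2 e z he hz
  have i2 := n2 e z⁻¹ he hw
  have a3 := n3 a z ha hz
  have a4 := n3 a z⁻¹ ha hw
  have b3 := n3 b z hb hz
  have b4 := n3 b z⁻¹ hb hw
  have c3 := n3 c z hc hz
  have c4 := n3 c z⁻¹ hc hw
  have d3 := n3 d z hd hz
  have d4 := n3 d z⁻¹ hd hw
  have i3 := n3 e z he hz
  have i4 := n3 e z⁻¹ he hw
  generalize qPochInf q (q * a * z) = A1 at *
  generalize qPochInf q (q * a * z⁻¹) = A2 at *
  generalize qPochInf q (q * b * z) = B1 at *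
  generalize qPochInf q (q * b * z⁻¹) = B2 at *
  generalize qPochInf q (q * c * z) = C1 at *
  generalize qPochInf q (q * c * z⁻¹) = C2 at *
  generalize qPochInf q (q * d * z) = D1 at *
  generalize qPochInf q (q * d * z⁻¹) = D2 at *
  generalize qPochInf q (q * e * z) = E1 at *
  generalize qPochInf q (q * e * z⁻¹) = E2 at *
  generalize qPochInf q (q * z ^ 2) = X1 at *
  generalize qPochInf q (q * z⁻¹ ^ 2) = X2 at *
  generalize qPochInf q (q * (a * b * c * d * e) * z) = Y1 at *
  generalize qPochInf q (q * (a * b * c * d * e) * z⁻¹) = Y2 at *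
  -- `M` is the common factor of both sides; `key` is the identity that remains after its removal.
  set M := X1 * X2 * Y1 * Y2 / (A1 * A2 * B1 * B2 * C1 * C2 * D1 * D2 * E1 * E2 *
    ((1 - a * z) * (1 - a * z⁻¹) * (1 - b * z) * (1 - b * z⁻¹) * (1 - c * z) * (1 - c * z⁻¹) *
      (1 - d * z) * (1 - d * z⁻¹) * (1 - e * z) * (1 - e * z⁻¹))) with hM
  have key : (1 - a * b) * (1 - a * c) * (1 - a * d) * (1 - a * e) *
      ((1 - z ^ 2) * (1 - z⁻¹ ^ 2) * ((1 - a * b * c * d * e * z) *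
        (1 - a * b * c * d * e * z⁻¹))) -
      (1 - a * c * d * e) * (1 - a * b * d * e) * (1 - a * b * c * e) * (1 - a * b * c * d) *
        ((1 - z ^ 2) * (1 - z⁻¹ ^ 2) * ((1 - a * z) * (1 - a * z⁻¹))) =
      a * (1 - a * (a * b * c * d * e)) *
        (z * (1 - z ^ 2) * (1 - a * b * c * d * e * z) * ((1 - a * z⁻¹) * (1 - b * z⁻¹) *
            (1 - c * z⁻¹) * (1 - d * z⁻¹) * (1 - e * z⁻¹)) +
          z⁻¹ * (1 - z⁻¹ ^ 2) * (1 - a * b * c * d * e * z⁻¹) * ((1 - a * z) * (1 - b * z) *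
            (1 - c * z) * (1 - d * z) * (1 - e * z))) := by
    field_simp
    ring
  generalize 1 - a * z = a5 at *
  generalize 1 - a * z⁻¹ = a6 at *
  generalize 1 - b * z = b5 at *
  generalize 1 - b * z⁻¹ = b6 at *
  generalize 1 - c * z = c5 at *
  generalize 1 - c * z⁻¹ = c6 at *
  generalize 1 - d * z = d5 at *
  generalize 1 - d * z⁻¹ = d6 at *
  generalize 1 - e * z = e5 at *
  generalize 1 - e * z⁻¹ = e6 at *
  generalize z⁻¹ = w at *
  calc _ = M * ((1 - a * b) * (1 - a * c) * (1 - a * d) * (1 - a * e) *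
      ((1 - z ^ 2) * (1 - w ^ 2) * ((1 - a * b * c * d * e * z) *
        (1 - a * b * c * d * e * w))) -
      (1 - a * c * d * e) * (1 - a * b * d * e) * (1 - a * b * c * e) * (1 - a * b * c * d) *
        ((1 - z ^ 2) * (1 - w ^ 2) * (a5 * a6))) := by
        rw [mul_sub]
        rw [hM]; field_simp
    _ = _ := by
        rw [key, mul_left_comm]
        congr 1
        rw [mul_add]
        congr 1
        · rw [hM]; field_simp
        · rw [hM]; field_simp

theorem continuous_qPochPair_sphere (h0 : 0 < q) (h1 : q < 1) (t : ℂ) :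
    ContinuousOn (qPochPair q t) (Metric.sphere 0 1) := by
  have hz : ∀ z ∈ Metric.sphere (0 : ℂ) 1, z ≠ 0 := fun z hz h => by simp [h] at hz
  have hc := continuous_qPochInf h0 h1
  exact (hc.comp_continuousOn (by fun_prop)).mul
    (hc.comp_continuousOn (continuousOn_const.mul (continuousOn_id.inv₀ hz)))

theorem circleIntegrable_rahmanKernel (h0 : 0 < q) (h1 : q < 1) {a b c d e : ℂ}
    (ha : ‖a‖ < 1) (hb : ‖b‖ < 1) (hc : ‖c‖ < 1) (hd : ‖d‖ < 1) (he : ‖e‖ < 1) :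
    CircleIntegrable (rahmanKernel q a b c d e) 0 1 := by
  refine ContinuousOn.circleIntegrable zero_le_one ?_
  have hz : ∀ z ∈ Metric.sphere (0 : ℂ) 1, z ≠ 0 := fun z hz h => by simp [h] at hz
  have hp := continuous_qPochPair_sphere h0 h1
  have hcq := continuous_qPochInf h0 h1
  refine ContinuousOn.div ?_ ((((hp a).mul (hp b)).mul (hp c)).mul (hp d) |>.mul (hp e)) ?_
  · exact ((hcq.comp_continuousOn (by fun_prop)).mul
      (hcq.comp_continuousOn ((continuousOn_id.inv₀ hz).pow 2))).mul (hp _)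
  · intro z hz
    have hz1 : ‖z‖ = 1 := by simpa using hz
    exact mul_ne_zero (mul_ne_zero (mul_ne_zero (mul_ne_zero (qPochPair_ne_zero h0 h1 ha hz1)
      (qPochPair_ne_zero h0 h1 hb hz1)) (qPochPair_ne_zero h0 h1 hc hz1))
      (qPochPair_ne_zero h0 h1 hd hz1)) (qPochPair_ne_zero h0 h1 he hz1)

theorem circleAverage_const_mul (k : ℂ) (f : ℂ → ℂ) :
    Real.circleAverage (fun z => k * f z) 0 1 = k * Real.circleAverage f 0 1 :=
  Real.circleAverage_fun_smul (a := k) (f := f)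

theorem circleAverage_rahmanKernel_contiguous (h0 : 0 < q) (h1 : q < 1) {a b c d e : ℂ}
    (ha : ‖a‖ < 1) (hb : ‖b‖ < 1) (hc : ‖c‖ < 1) (hd : ‖d‖ < 1) (he : ‖e‖ < 1) :
    (1 - a * b) * (1 - a * c) * (1 - a * d) * (1 - a * e) *
        Real.circleAverage (rahmanKernel q a b c d e) 0 1 =
      (1 - a * c * d * e) * (1 - a * b * d * e) * (1 - a * b * c * e) * (1 - a * b * c * d) *
        Real.circleAverage (rahmanKernel q (a * q) b c d e) 0 1 := by
  have haq : ‖a * q‖ < 1 := by simpa using norm_mul_pow_lt_one h0 h1 ha 1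
  have i1 := circleIntegrable_rahmanKernel h0 h1 ha hb hc hd he
  have i2 := circleIntegrable_rahmanKernel h0 h1 haq hb hc hd he
  have hdiff : ∀ z : ℂ, q ≤ ‖z‖ → ‖z‖ ≤ 1 → DifferentiableAt ℂ (rahmanAux q a b c d e) z :=
    fun z => differentiableAt_rahmanAux h0 h1 ha hb hc hd he
  have hcont : ContinuousOn (rahmanAux q a b c d e) (Metric.sphere 0 1) := fun z hz => by
    have hz1 : ‖z‖ = 1 := by simpa using hz
    exact (hdiff z (by rw [hz1]; exact h1.le) hz1.le).continuousAt.continuousWithinAt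
  have hz : ∀ z ∈ Metric.sphere (0 : ℂ) 1, z ≠ 0 := fun z hz h => by simp [h] at hz
  have j1 : CircleIntegrable (rahmanAux q a b c d e) 0 1 :=
    hcont.circleIntegrable zero_le_one
  have j2 : CircleIntegrable (fun z => rahmanAux q a b c d e z⁻¹) 0 1 := by
    refine ContinuousOn.circleIntegrable zero_le_one ?_
    exact hcont.comp (continuousOn_id.inv₀ hz) fun z hz => by simpa using hz
  have hk : ∀ (K : ℂ) {f : ℂ → ℂ}, CircleIntegrable f 0 1 →
      CircleIntegrable (fun z => K * f z) 0 1 := fun K _ hf => IntervalIntegrable.const_mul hf K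
  have h3 : Real.circleAverage (fun z =>
      (1 - a * b) * (1 - a * c) * (1 - a * d) * (1 - a * e) * rahmanKernel q a b c d e z -
      (1 - a * c * d * e) * (1 - a * b * d * e) * (1 - a * b * c * e) * (1 - a * b * c * d) *
        rahmanKernel q (a * q) b c d e z) 0 1 =
      Real.circleAverage (fun z => a * (1 - a * (a * b * c * d * e)) *
      (rahmanAux q a b c d e z + rahmanAux q a b c d e z⁻¹)) 0 1 :=
    Real.circleAverage_congr_sphere fun z hz =>
      rahmanKernel_contiguous h0 h1 ha hb hc hd he (by simpa using hz)
  rw [Real.circleAverage_fun_sub (hk _ i1) (hk _ i2),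
    circleAverage_const_mul, circleAverage_const_mul, circleAverage_const_mul,
    Real.circleAverage_fun_add j1 j2, Real.circleAverage_zero_one_congr_inv,
    circleAverage_rahmanAux h0 h1 ha hb hc hd he] at h3
  linear_combination h3

theorem tendsto_circleAverage_rahmanKernel (h0 : 0 < q) (h1 : q < 1) {a b c d e : ℂ}
    (ha : ‖a‖ < 1) (hb : ‖b‖ < 1) (hc : ‖c‖ < 1) (hd : ‖d‖ < 1) (he : ‖e‖ < 1) :
    Tendsto (fun n : ℕ => Real.circleAverage (rahmanKernel q (a * (q : ℂ) ^ n) b c d e) 0 1)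
      atTop (𝓝 (Real.circleAverage (rahmanKernel q 0 b c d e) 0 1)) := by
  have hcq := continuous_qPochInf h0 h1
  have hz0 : ∀ θ : ℝ, circleMap 0 1 θ ≠ 0 := fun θ => circleMap_ne_center one_ne_zero
  have hz1 : ∀ θ : ℝ, ‖circleMap 0 1 θ‖ = 1 := fun θ => by simp
  have hc1 : Continuous fun p : {t : ℂ // ‖t‖ < 1} × ℝ => circleMap 0 1 p.2 := by fun_prop
  have hc2 : Continuous fun p : {t : ℂ // ‖t‖ < 1} × ℝ => (circleMap 0 1 p.2)⁻¹ :=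
    hc1.inv₀ fun p => hz0 p.2
  have hpair : ∀ f : {t : ℂ // ‖t‖ < 1} × ℝ → ℂ, Continuous f →
      Continuous fun p => qPochPair q (f p) (circleMap 0 1 p.2) := fun f hf =>
    (hcq.comp (hf.mul hc1)).mul (hcq.comp (hf.mul hc2))
  -- Restricting the parameter to the open disc keeps the denominator nonzero everywhere, so joint
  -- continuity holds and passes to the integral.
  have hcont : Continuous (Function.uncurry fun (t : {t : ℂ // ‖t‖ < 1}) (θ : ℝ) =>
      rahmanKernel q t b c d e (circleMap 0 1 θ)) := by
    have ht : Continuous fun p : {t : ℂ // ‖t‖ < 1} × ℝ => (p.1 : ℂ) := by fun_prop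
    simp only [Function.uncurry_def, rahmanKernel]
    refine Continuous.div (((hcq.comp (hc1.pow 2)).mul (hcq.comp (hc2.pow 2))).mul
      (hpair _ (by fun_prop))) (((((hpair _ ht).mul (hpair _ continuous_const)).mul
      (hpair _ continuous_const)).mul (hpair _ continuous_const)).mul
      (hpair _ continuous_const)) fun p => ?_
    exact mul_ne_zero (mul_ne_zero (mul_ne_zero (mul_ne_zero
      (qPochPair_ne_zero h0 h1 p.1.2 (hz1 _))
      (qPochPair_ne_zero h0 h1 hb (hz1 _))) (qPochPair_ne_zero h0 h1 hc (hz1 _)))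
      (qPochPair_ne_zero h0 h1 hd (hz1 _))) (qPochPair_ne_zero h0 h1 he (hz1 _))
  have hI : Continuous fun t : {t : ℂ // ‖t‖ < 1} =>
      Real.circleAverage (rahmanKernel q t b c d e) 0 1 := by
    simp only [Real.circleAverage_def]
    exact (intervalIntegral.continuous_parametric_intervalIntegral_of_continuous' hcont 0
      (2 * Real.pi)).const_smul _
  have hseq : Tendsto (fun n : ℕ => (⟨a * (q : ℂ) ^ n, norm_mul_pow_lt_one h0 h1 ha n⟩ :
      {t : ℂ // ‖t‖ < 1})) atTop (𝓝 ⟨0, by simp⟩) :=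
    tendsto_subtype_rng.2 (tendsto_mul_pow_zero h0 h1 a)
  have h := (hI.tendsto (⟨0, by simp⟩ : {t : ℂ // ‖t‖ < 1})).comp hseq
  simpa only [Function.comp_def] using h

theorem rahmanKernel_rotate (a b c d e z : ℂ) :
    rahmanKernel q a b c d e z = rahmanKernel q b c d e a z := by
  unfold rahmanKernel
  rw [show b * c * d * e * a = a * b * c * d * e by ring]
  congr 1
  ring

/-- Iterating the contiguous relation sends `a` to `0` in the limit. Symmetry of the kernel then
moves that zero to the last slot, so the same statement applies to the next parameter. -/
theorem circleAverage_rahmanKernel_reduce (h0 : 0 < q) (h1 : q < 1) {a b c d e : ℂ}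
    (ha : ‖a‖ < 1) (hb : ‖b‖ < 1) (hc : ‖c‖ < 1) (hd : ‖d‖ < 1) (he : ‖e‖ < 1) :
    qPochInf q (a * b) * qPochInf q (a * c) * qPochInf q (a * d) * qPochInf q (a * e) *
        Real.circleAverage (rahmanKernel q a b c d e) 0 1 =
      qPochInf q (a * c * d * e) * qPochInf q (a * b * d * e) * qPochInf q (a * b * c * e) *
        qPochInf q (a * b * c * d) * Real.circleAverage (rahmanKernel q b c d e 0) 0 1 := by
  have hiter : ∀ n : ℕ, qPoch q (a * b) n * qPoch q (a * c) n * qPoch q (a * d) n *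
        qPoch q (a * e) n * Real.circleAverage (rahmanKernel q a b c d e) 0 1 =
      qPoch q (a * c * d * e) n * qPoch q (a * b * d * e) n * qPoch q (a * b * c * e) n *
        qPoch q (a * b * c * d) n *
          Real.circleAverage (rahmanKernel q (a * (q : ℂ) ^ n) b c d e) 0 1 := by
    intro n
    induction n with
    | zero => simp [qPoch]
    | succ n ih =>
      have h2 := circleAverage_rahmanKernel_contiguous h0 h1
        (norm_mul_pow_lt_one h0 h1 ha n) hb hc hd he
      simp only [qPoch_succ, pow_succ, ← mul_assoc] at h2 ih ⊢
      linear_combination (1 - a * b * (q : ℂ) ^ n) * (1 - a * c * (q : ℂ) ^ n) *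
        (1 - a * d * (q : ℂ) ^ n) * (1 - a * e * (q : ℂ) ^ n) * ih +
        qPoch q (a * c * d * e) n * qPoch q (a * b * d * e) n * qPoch q (a * b * c * e) n *
        qPoch q (a * b * c * d) n * h2
  have ht := tendsto_qPoch h0 h1
  have hL := ((((ht (a * b)).mul (ht (a * c))).mul (ht (a * d))).mul (ht (a * e))).mul_const
    (Real.circleAverage (rahmanKernel q a b c d e) 0 1)
  have hR := ((((ht (a * c * d * e)).mul (ht (a * b * d * e))).mul (ht (a * b * c * e))).mul
    (ht (a * b * c * d))).mul (tendsto_circleAverage_rahmanKernel h0 h1 ha hb hc hd he)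
  have h := tendsto_nhds_unique hL (by simpa only [hiter] using hR)
  rw [h]
  congr 2
  exact funext fun z => rahmanKernel_rotate 0 b c d e z

/-- Factorwise `(x²;p²)_∞ = (x;p)_∞(-x;p)_∞`, and each product to base `p` splits into its even and
odd factors, which have base `q = p²`. -/
theorem qPochInf_sq (h0 : 0 < q) (h1 : q < 1) {p : ℝ} (hp0 : 0 < p) (hp : p ^ 2 = q) (x : ℂ) :
    qPochInf q (x ^ 2) =
      qPochInf q x * qPochInf q (p * x) * (qPochInf q (-x) * qPochInf q (p * -x)) := by
  have hp1 : p < 1 := by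
    by_contra! h
    nlinarith
  have hpq : ∀ k : ℕ, (q : ℂ) ^ k = (p : ℂ) ^ (2 * k) := fun k => by
    rw [← hp]; push_cast; ring
  have hsplit : ∀ y : ℂ, qPochInf p y = qPochInf q y * qPochInf q (p * y) := by
    intro y
    have e1 : ∀ k : ℕ, 1 - y * (p : ℂ) ^ (2 * k) = 1 - y * (q : ℂ) ^ k := fun k => by rw [hpq]
    have e2 : ∀ k : ℕ, 1 - y * (p : ℂ) ^ (2 * k + 1) = 1 - p * y * (q : ℂ) ^ k := fun k => by
      rw [hpq]; ring
    have h := tprod_even_mul_odd (f := fun k : ℕ => 1 - y * (p : ℂ) ^ k)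
      (by simpa only [e1] using multipliable_qPochInf h0 h1 y)
      (by simpa only [e2] using multipliable_qPochInf h0 h1 (p * y))
    simp only [e1, e2] at h
    exact h.symm
  rw [← hsplit, ← hsplit]
  simp only [qPochInf]
  rw [← (multipliable_qPochInf hp0 hp1 _).tprod_mul (multipliable_qPochInf hp0 hp1 _)]
  refine tprod_congr fun k => ?_
  rw [hpq]; ring

theorem circleAverage_sq : Real.circleAverage (fun z : ℂ => z ^ 2) 0 1 = 0 := by
  have h := circleAverage_of_differentiable_on_off_countable (f := fun z : ℂ => z ^ 2) (c := 0)
    (R := 1) Set.countable_empty (by fun_prop) (fun z _ => by fun_prop)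
  simpa using h

/-- For the parameters `q, -q, √q, -√q, 0`, `qPochInf_sq` makes the denominator cancel all of
`(z²,z⁻²;q)_∞` except `(1 - z²)(1 - z⁻²)`, whose mean is the constant term `2`. -/
theorem rahmanKernel_special (h0 : 0 < q) (h1 : q < 1) {p : ℝ} (hp0 : 0 < p) (hp : p ^ 2 = q)
    {z : ℂ} (hz : ‖z‖ = 1) :
    rahmanKernel q q (-q) p (-p) 0 z = 2 - (z ^ 2 + z⁻¹ ^ 2) := by
  have hp1 : p < 1 := by
    by_contra! h
    nlinarith
  have hz0 : z ≠ 0 := norm_pos_iff.1 (by rw [hz]; exact one_pos)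
  have hqn := norm_ofReal_lt_one h0 h1
  have hpn := norm_ofReal_lt_one hp0 hp1
  have n1 := qPochPair_ne_zero h0 h1 hqn hz
  have n2 := qPochPair_ne_zero h0 h1 (by rwa [norm_neg] : ‖-(q : ℂ)‖ < 1) hz
  have n3 := qPochPair_ne_zero h0 h1 hpn hz
  have n4 := qPochPair_ne_zero h0 h1 (by rwa [norm_neg] : ‖-(p : ℂ)‖ < 1) hz
  have e0 : qPochPair q 0 z = 1 := by simp [qPochPair, qPochInf_zero]
  have e1 : ∀ x : ℂ, qPochInf q (x ^ 2) = (1 - x ^ 2) * (qPochInf q (q * x) *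
      qPochInf q (-q * x) * qPochInf q (p * x) * qPochInf q (-p * x)) := fun x => by
    rw [qPochInf_sq h0 h1 hp0 hp, qPochInf_eq_one_sub_mul h0 h1 x,
      qPochInf_eq_one_sub_mul h0 h1 (-x), mul_comm x, show -x * (q : ℂ) = -q * x by ring,
      show (p : ℂ) * -x = -p * x by ring]
    ring
  have e2 : rahmanKernel q q (-q) p (-p) 0 z = (1 - z ^ 2) * (1 - z⁻¹ ^ 2) *
      (qPochPair q q z * qPochPair q (-q) z * qPochPair q p z * qPochPair q (-p) z) /
      (qPochPair q q z * qPochPair q (-q) z * qPochPair q p z * qPochPair q (-p) z) := by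
    rw [rahmanKernel, mul_zero, e0, mul_one, mul_one, e1, e1]
    congr 1
    simp only [qPochPair]
    ring
  rw [e2, mul_div_assoc, div_self (mul_ne_zero (mul_ne_zero (mul_ne_zero n1 n2) n3) n4), mul_one]
  field_simp
  ring

theorem circleAverage_rahmanKernel_special (h0 : 0 < q) (h1 : q < 1) {p : ℝ} (hp0 : 0 < p)
    (hp : p ^ 2 = q) : Real.circleAverage (rahmanKernel q q (-q) p (-p) 0) 0 1 = 2 := by
  have hz : ∀ z ∈ Metric.sphere (0 : ℂ) 1, z ≠ 0 := fun z hz h => by simp [h] at hz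
  have h : Real.circleAverage (rahmanKernel q q (-q) p (-p) 0) 0 1 =
      Real.circleAverage (fun z : ℂ => 2 - (z ^ 2 + z⁻¹ ^ 2)) 0 1 :=
    Real.circleAverage_congr_sphere fun z hz =>
      rahmanKernel_special h0 h1 hp0 hp (by simpa using hz)
  have i1 : CircleIntegrable (fun z : ℂ => z ^ 2) 0 1 :=
    ContinuousOn.circleIntegrable zero_le_one (by fun_prop)
  have i2 : CircleIntegrable (fun z : ℂ => z⁻¹ ^ 2) 0 1 :=
    ContinuousOn.circleIntegrable zero_le_one ((continuousOn_id.inv₀ hz).pow 2)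
  have i3 : CircleIntegrable (fun _ : ℂ => (2 : ℂ)) 0 1 :=
    ContinuousOn.circleIntegrable zero_le_one (by fun_prop)
  have i4 : CircleIntegrable (fun z : ℂ => z ^ 2 + z⁻¹ ^ 2) 0 1 := i1.add i2
  rw [h, Real.circleAverage_fun_sub i3 i4, Real.circleAverage_fun_add i1 i2,
    Real.circleAverage_zero_one_congr_inv (f := fun z : ℂ => z ^ 2), circleAverage_sq,
    Real.circleAverage_const]
  norm_num

theorem circleAverage_rahmanKernel_eq_mul_zero (h0 : 0 < q) (h1 : q < 1) {a b c d e : ℂ}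
    (ha : ‖a‖ < 1) (hb : ‖b‖ < 1) (hc : ‖c‖ < 1) (hd : ‖d‖ < 1) (he : ‖e‖ < 1) :
    qPochInf q (a * b) * qPochInf q (a * c) * qPochInf q (a * d) * qPochInf q (a * e) *
      (qPochInf q (b * c) * qPochInf q (b * d) * qPochInf q (b * e)) *
      (qPochInf q (c * d) * qPochInf q (c * e)) * qPochInf q (d * e) *
        Real.circleAverage (rahmanKernel q a b c d e) 0 1 =
      qPochInf q (a * c * d * e) * qPochInf q (a * b * d * e) * qPochInf q (a * b * c * e) *
        qPochInf q (a * b * c * d) * qPochInf q (b * c * d * e) *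
          Real.circleAverage (rahmanKernel q 0 0 0 0 0) 0 1 := by
  have hn : ‖(0 : ℂ)‖ < 1 := by simp
  have r1 := circleAverage_rahmanKernel_reduce h0 h1 ha hb hc hd he
  have r2 := circleAverage_rahmanKernel_reduce h0 h1 hb hc hd he hn
  have r3 := circleAverage_rahmanKernel_reduce h0 h1 hc hd he hn hn
  have r4 := circleAverage_rahmanKernel_reduce h0 h1 hd he hn hn hn
  have r5 := circleAverage_rahmanKernel_reduce h0 h1 he hn hn hn hn
  simp only [mul_zero, qPochInf_zero, mul_one, one_mul] at r2 r3 r4 r5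
  rw [r5] at r4
  rw [← r4, ← r3]
  linear_combination (qPochInf q (b * c) * qPochInf q (b * d) * qPochInf q (b * e)) *
      (qPochInf q (c * d) * qPochInf q (c * e)) * qPochInf q (d * e) * r1 +
    qPochInf q (a * c * d * e) * qPochInf q (a * b * d * e) * qPochInf q (a * b * c * e) *
      qPochInf q (a * b * c * d) *
      (qPochInf q (c * d) * qPochInf q (c * e)) * qPochInf q (d * e) * r2

/-- The constant is independent of the parameters in `circleAverage_rahmanKernel_eq_mul_zero`, so
the special choice determines it once the resulting products are simplified. -/
theorem circleAverage_rahmanKernel_zero (h0 : 0 < q) (h1 : q < 1) :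
    qPochInf q q * Real.circleAverage (rahmanKernel q 0 0 0 0 0) 0 1 = 2 := by
  obtain ⟨p, hp0, hp⟩ : ∃ p : ℝ, 0 < p ∧ p ^ 2 = q :=
    ⟨Real.sqrt q, Real.sqrt_pos.2 h0, Real.sq_sqrt h0.le⟩
  have hp1 : p < 1 := by
    by_contra! h
    nlinarith
  have hqn := norm_ofReal_lt_one h0 h1
  have hpn := norm_ofReal_lt_one hp0 hp1
  have hpc : (p : ℂ) ^ 2 = q := by rw [← hp]; push_cast; ring
  have h := circleAverage_rahmanKernel_eq_mul_zero h0 h1 (a := q) (b := -q) (c := p) (d := -p)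
    (e := 0) hqn (by rwa [norm_neg]) hpn (by rwa [norm_neg]) (by simp)
  rw [circleAverage_rahmanKernel_special h0 h1 hp0 hp] at h
  simp only [mul_zero, qPochInf_zero, mul_one, one_mul] at h
  rw [show (q : ℂ) * -q = -q * q by ring, show -(q : ℂ) * p = -(q * p) by ring,
    show -(q : ℂ) * -p = q * p by ring, show (q : ℂ) * -p = -(q * p) by ring,
    show (p : ℂ) * -p = -q by rw [← hpc]; ring,
    show -(q : ℂ) * q * p * -p = q * q * q by
      linear_combination (q : ℂ) * q * hpc] at h
  have e1 := qPochInf_sq h0 h1 hp0 hp q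
  have e2 := qPochInf_eq_one_sub_mul h0 h1 q
  have e3 := qPochInf_eq_one_sub_mul h0 h1 (q * q)
  have e4 := qPochInf_eq_one_sub_mul h0 h1 (-q)
  rw [show (p : ℂ) * q = q * p by ring, show (p : ℂ) * -q = -(q * p) by ring, sq] at e1
  have n1 : qPochInf q ((q : ℂ) * q) ≠ 0 :=
    qPochInf_ne_zero_of_norm_lt h0 h1 (by simpa using norm_mul_pow_lt_one h0 h1 hqn 1)
  -- Obtained by factoring `(q²;q)_∞` with `qPochInf_sq` at `x = q`, writing `(q;q)_∞ = (1 -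
  -- q)(q²;q)_∞`, and cancelling `(q²;q)_∞`.
  have e5 : (1 - (q : ℂ)) * qPochInf q (q * p) * (qPochInf q (-q) * qPochInf q (-(q * p))) = 1 := by
    apply mul_left_cancel₀ n1
    rw [mul_one]
    conv_rhs => rw [e1, e2]
    ring
  have e6 : (1 - (q : ℂ) * q) * qPochInf q (q * p) *
      (qPochInf q (-q * q) * qPochInf q (-(q * p))) = 1 := by
    linear_combination e5 - (1 - (q : ℂ)) * qPochInf q (q * p) * qPochInf q (-(q * p)) * e4
  rw [e2, e3]
  linear_combination -(1 - (q : ℂ)) * (1 - (q : ℂ) * q) * h +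
    2 * (1 - (q : ℂ) * q) * qPochInf q (q * p) *
      (qPochInf q (-q * q) * qPochInf q (-(q * p))) * e5 + 2 * e6

/-- Rahman's `q`-beta integral, as an average over the unit circle. -/
theorem circleAverage_rahmanKernel (h0 : 0 < q) (h1 : q < 1) {a b c d e : ℂ}
    (ha : ‖a‖ < 1) (hb : ‖b‖ < 1) (hc : ‖c‖ < 1) (hd : ‖d‖ < 1) (he : ‖e‖ < 1) :
    Real.circleAverage (rahmanKernel q a b c d e) 0 1 =
      2 * (qPochInf q (a * b * c * d) * qPochInf q (a * b * c * e) * qPochInf q (a * b * d * e) *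
        qPochInf q (a * c * d * e) * qPochInf q (b * c * d * e)) /
      (qPochInf q q * (qPochInf q (a * b) * qPochInf q (a * c) * qPochInf q (a * d) *
        qPochInf q (a * e) * qPochInf q (b * c) * qPochInf q (b * d) * qPochInf q (b * e) *
        qPochInf q (c * d) * qPochInf q (c * e) * qPochInf q (d * e))) := by
  have n : ∀ s t : ℂ, ‖s‖ < 1 → ‖t‖ < 1 → qPochInf q (s * t) ≠ 0 := fun s t hs ht =>
    qPochInf_ne_zero_of_norm_lt h0 h1 (by
      rw [norm_mul]; exact mul_lt_one_of_nonneg_of_lt_one_left (norm_nonneg _) hs ht.le)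
  have nq := qPochInf_ne_zero_of_norm_lt h0 h1 (norm_ofReal_lt_one h0 h1)
  have hm := circleAverage_rahmanKernel_eq_mul_zero h0 h1 ha hb hc hd he
  have hz := circleAverage_rahmanKernel_zero h0 h1
  rw [eq_div_iff (by
    repeat' apply mul_ne_zero
    exact nq
    all_goals apply n <;> assumption)]
  rw [← hz]
  linear_combination qPochInf q q * hm

end RahmanIntegral

/-! ### The integrand as a series of Rahman kernels -/

section AskeyWilsonExpansion

variable {q : ℝ}

theorem exists_norm_qPochInf_le (h0 : 0 < q) (h1 : q < 1) (ρ : ℝ) :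
    ∃ C : ℝ, 0 < C ∧ ∀ x : ℂ, ‖x‖ ≤ ρ → ‖qPochInf q x‖ ≤ C := by
  obtain ⟨C, hC, hC'⟩ := exists_norm_qPoch_le h0 h1 ρ
  exact ⟨C, hC, fun x hx => le_of_tendsto (tendsto_qPoch h0 h1 x).norm
    (Eventually.of_forall fun n => hC' x hx n)⟩

/-- The weight of the five-parameter integral on the unit circle. -/
noncomputable def circleWeight (q : ℝ) (a b c d r z : ℂ) : ℂ :=
  qPochInf q (z ^ 2) * qPochInf q (z⁻¹ ^ 2) /
    (qPochPair q a z * qPochPair q b z * qPochPair q c z * qPochPair q d z * qPochPair q r z)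

theorem exp_eq_circleMap (θ : ℝ) : Complex.exp (θ * Complex.I) = circleMap 0 1 θ := by
  simp [circleMap]

theorem exp_neg_eq_circleMap_inv (θ : ℝ) :
    Complex.exp (-(θ * Complex.I)) = (circleMap 0 1 θ)⁻¹ := by
  rw [Complex.exp_neg, exp_eq_circleMap]

theorem hProd_cos_eq_qPochPair (h0 : 0 < q) (h1 : q < 1) (θ : ℝ) (t : ℂ) :
    hProd (Real.cos θ) t q = qPochPair q t (circleMap 0 1 θ) := by
  rw [hProd_cos h0 h1, exp_eq_circleMap, exp_neg_eq_circleMap_inv, qPochPair]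

theorem hProd_div_hProds_eq_circleWeight (h0 : 0 < q) (h1 : q < 1) (θ : ℝ) (a b c d r : ℂ) :
    hProd (Real.cos (2 * θ)) 1 q / hProds (Real.cos θ) ![a, b, c, d, r] q =
      circleWeight q a b c d r (circleMap 0 1 θ) := by
  have e : circleMap 0 1 (2 * θ) = circleMap 0 1 θ ^ 2 := by
    rw [← exp_eq_circleMap, ← exp_eq_circleMap, ← Complex.exp_nat_mul]
    congr 1
    push_cast
    ring
  simp only [hProds, hProd_cos_eq_qPochPair h0 h1, Fin.prod_univ_five, circleWeight, e]
  rw [qPochPair, one_mul, one_mul, inv_pow]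
  rfl

/-- Multiplying the weight by `(az,a/z;q)_k` cancels the first `k` factors of its `a`-denominator,
that is, replaces `a` by `aq^k`; the remaining products are the kernel's numerator for the shifted
parameter. -/
theorem rahmanKernel_mul_pow (h0 : 0 < q) (h1 : q < 1) {a b c d r z : ℂ} (ha : ‖a‖ < 1)
    (hz : ‖z‖ = 1) (k : ℕ) :
    rahmanKernel q (a * (q : ℂ) ^ k) b c d r z =
      circleWeight q a b c d r z * (qPoch q (a * z) k * qPoch q (a * z⁻¹) k *
        (qPochInf q (a * z * (b * c * d * r) * (q : ℂ) ^ k) *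
          qPochInf q (a * z⁻¹ * (b * c * d * r) * (q : ℂ) ^ k))) := by
  have n1 : qPoch q (a * z) k ≠ 0 :=
    qPoch_ne_zero_of_norm_lt h0 h1 (by rwa [norm_mul, hz, mul_one]) k
  have n2 : qPoch q (a * z⁻¹) k ≠ 0 :=
    qPoch_ne_zero_of_norm_lt h0 h1 (by rwa [norm_mul, norm_inv, hz, inv_one, mul_one]) k
  have e1 : qPochPair q a z = qPoch q (a * z) k * qPoch q (a * z⁻¹) k *
      qPochPair q (a * (q : ℂ) ^ k) z := by
    rw [qPochPair, qPochPair, qPochInf_eq_mul h0 h1 (a * z) k, qPochInf_eq_mul h0 h1 (a * z⁻¹) k,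
      mul_right_comm a z, mul_right_comm a z⁻¹]
    ring
  have e2 : qPochPair q (a * (q : ℂ) ^ k * b * c * d * r) z =
      qPochInf q (a * z * (b * c * d * r) * (q : ℂ) ^ k) *
          qPochInf q (a * z⁻¹ * (b * c * d * r) * (q : ℂ) ^ k) := by
    rw [qPochPair]
    congr 2 <;> ring
  rw [rahmanKernel, circleWeight, e1, e2]
  generalize qPochPair q (a * (q : ℂ) ^ k) z = X
  generalize qPochPair q b z = Y1
  generalize qPochPair q c z = Y2
  generalize qPochPair q d z = Y3
  generalize qPochPair q r z = Y4
  generalize qPoch q (a * z) k = P1 at *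
  generalize qPoch q (a * z⁻¹) k = P2 at *
  rw [div_mul_eq_mul_div, show P1 * P2 * X * Y1 * Y2 * Y3 * Y4 =
    (P1 * P2) * (X * Y1 * Y2 * Y3 * Y4) by ring, ← mul_div_mul_left _ _ (mul_ne_zero n1 n2)]
  congr 1
  ring

/-- In the form given by `rahmanKernel_mul_pow`, the denominator no longer depends on `k`: it is
bounded through compactness of the circle, and the other factors by the uniform product bounds. -/
theorem exists_norm_rahmanKernel_le (h0 : 0 < q) (h1 : q < 1) {a b c d r : ℂ}
    (ha : ‖a‖ < 1) (hb : ‖b‖ < 1) (hc : ‖c‖ < 1) (hd : ‖d‖ < 1) (hr : ‖r‖ < 1) :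
    ∃ C : ℝ, 0 < C ∧ ∀ (k : ℕ) (z : ℂ), ‖z‖ = 1 →
      ‖rahmanKernel q (a * (q : ℂ) ^ k) b c d r z‖ ≤ C := by
  have hz : ∀ z ∈ Metric.sphere (0 : ℂ) 1, z ≠ 0 := fun z hz h => by simp [h] at hz
  have hp := continuous_qPochPair_sphere h0 h1
  have hcq := continuous_qPochInf h0 h1
  have hcont : ContinuousOn (circleWeight q a b c d r) (Metric.sphere 0 1) := by
    refine ContinuousOn.div ?_ ((((hp a).mul (hp b)).mul (hp c)).mul (hp d) |>.mul (hp r)) ?_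
    · exact (hcq.comp_continuousOn (by fun_prop)).mul
        (hcq.comp_continuousOn ((continuousOn_id.inv₀ hz).pow 2))
    · intro z hz
      have hz1 : ‖z‖ = 1 := by simpa using hz
      exact mul_ne_zero (mul_ne_zero (mul_ne_zero (mul_ne_zero (qPochPair_ne_zero h0 h1 ha hz1)
        (qPochPair_ne_zero h0 h1 hb hz1)) (qPochPair_ne_zero h0 h1 hc hz1))
        (qPochPair_ne_zero h0 h1 hd hz1)) (qPochPair_ne_zero h0 h1 hr hz1)
  obtain ⟨C1, hC1⟩ := (isCompact_sphere (0 : ℂ) 1).exists_bound_of_continuousOn hcont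
  obtain ⟨C2, p2, hC2⟩ := exists_norm_qPoch_le h0 h1 ‖a‖
  obtain ⟨C3, p3, hC3⟩ := exists_norm_qPochInf_le h0 h1 (‖a‖ * ‖b * c * d * r‖)
  have p1 : 0 ≤ C1 := (norm_nonneg _).trans (hC1 1 (by simp))
  refine ⟨C1 * (C2 * C2 * (C3 * C3)) + 1, by positivity, fun k z hz => ?_⟩
  have hq : ‖(q : ℂ) ^ k‖ ≤ 1 := by
    rw [norm_pow, Complex.norm_real, Real.norm_of_nonneg h0.le]
    exact pow_le_one₀ h0.le h1.le
  have b1 : ∀ x : ℂ, ‖x‖ = 1 → ‖qPoch q (a * x) k‖ ≤ C2 := fun x hx =>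
    hC2 _ (by rw [norm_mul, hx, mul_one]) k
  have b2 : ∀ x : ℂ, ‖x‖ = 1 → ‖qPochInf q (a * x * (b * c * d * r) * (q : ℂ) ^ k)‖ ≤ C3 :=
    fun x hx => hC3 _ (by
      rw [norm_mul, norm_mul, norm_mul a, hx, mul_one]
      exact mul_le_of_le_one_right (by positivity) hq)
  have hzi : ‖z⁻¹‖ = 1 := by rw [norm_inv, hz, inv_one]
  rw [rahmanKernel_mul_pow h0 h1 ha hz]
  simp only [norm_mul (circleWeight q a b c d r z), norm_mul (qPoch q (a * z) k),
    norm_mul (qPoch q (a * z) k * _), norm_mul (qPochInf q _)]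
  refine le_trans ?_ (le_add_of_nonneg_right zero_le_one)
  gcongr
  · exact hC1 z (by simpa using hz)
  · exact b1 z hz
  · exact b1 _ hzi
  · exact b2 z hz
  · exact b2 _ hzi

theorem rahmanKernel_inv (a b c d r z : ℂ) :
    rahmanKernel q a b c d r z⁻¹ = rahmanKernel q a b c d r z := by
  simp only [rahmanKernel, qPochPair, inv_inv]
  congr 1 <;> ring

theorem continuous_rahmanKernel_circleMap (h0 : 0 < q) (h1 : q < 1) {a b c d r : ℂ}
    (ha : ‖a‖ < 1) (hb : ‖b‖ < 1) (hc : ‖c‖ < 1) (hd : ‖d‖ < 1) (hr : ‖r‖ < 1) :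
    Continuous fun θ : ℝ => rahmanKernel q a b c d r (circleMap 0 1 θ) := by
  have hcq := continuous_qPochInf h0 h1
  have hz1 : ∀ θ : ℝ, ‖circleMap 0 1 θ‖ = 1 := fun θ => by simp
  have hc1 : Continuous fun θ : ℝ => circleMap 0 1 θ := by fun_prop
  have hc2 : Continuous fun θ : ℝ => (circleMap 0 1 θ)⁻¹ :=
    hc1.inv₀ fun θ => circleMap_ne_center one_ne_zero
  have hp : ∀ t, Continuous fun θ : ℝ => qPochPair q t (circleMap 0 1 θ) := fun t =>
    (hcq.comp (continuous_const.mul hc1)).mul (hcq.comp (continuous_const.mul hc2))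
  refine Continuous.div (((hcq.comp (hc1.pow 2)).mul (hcq.comp (hc2.pow 2))).mul
    (hp _)) (((((hp a).mul (hp b)).mul (hp c)).mul (hp d)).mul (hp r)) fun θ => ?_
  exact mul_ne_zero (mul_ne_zero (mul_ne_zero (mul_ne_zero
    (qPochPair_ne_zero h0 h1 ha (hz1 _))
    (qPochPair_ne_zero h0 h1 hb (hz1 _))) (qPochPair_ne_zero h0 h1 hc (hz1 _)))
    (qPochPair_ne_zero h0 h1 hd (hz1 _))) (qPochPair_ne_zero h0 h1 hr (hz1 _))

/-- Invariance of the kernel under `z → 1/z` makes the two half-circles contribute equally. -/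
theorem integral_rahmanKernel (h0 : 0 < q) (h1 : q < 1) {a b c d r : ℂ}
    (ha : ‖a‖ < 1) (hb : ‖b‖ < 1) (hc : ‖c‖ < 1) (hd : ‖d‖ < 1) (hr : ‖r‖ < 1) :
    ∫ θ in (0 : ℝ)..Real.pi, rahmanKernel q a b c d r (circleMap 0 1 θ) =
      Real.pi * Real.circleAverage (rahmanKernel q a b c d r) 0 1 := by
  have hcont := continuous_rahmanKernel_circleMap h0 h1 ha hb hc hd hr
  have hsplit := intervalIntegral.integral_add_adjacent_intervals
    (hcont.intervalIntegrable 0 Real.pi) (hcont.intervalIntegrable Real.pi (2 * Real.pi))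
    (μ := MeasureTheory.volume)
  have hrefl : ∫ θ in Real.pi..(2 * Real.pi), rahmanKernel q a b c d r (circleMap 0 1 θ) =
      ∫ θ in (0 : ℝ)..Real.pi, rahmanKernel q a b c d r (circleMap 0 1 θ) := by
    have h := intervalIntegral.integral_comp_sub_left (a := 0) (b := Real.pi)
      (fun θ => rahmanKernel q a b c d r (circleMap 0 1 θ)) (2 * Real.pi)
    rw [show 2 * Real.pi - Real.pi = Real.pi by ring, sub_zero] at h
    rw [← h]
    refine intervalIntegral.integral_congr fun θ _ => ?_
    have e : circleMap 0 1 (2 * Real.pi - θ) = (circleMap 0 1 θ)⁻¹ := by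
      rw [circleMap_zero_inv, sub_eq_neg_add, inv_one]
      exact periodic_circleMap 0 1 (-θ)
    simp only [e, rahmanKernel_inv]
  rw [Real.circleAverage_def, ← hsplit, hrefl, ← two_mul, Complex.real_smul]
  push_cast
  have hpi : (Real.pi : ℂ) ≠ 0 := Complex.ofReal_ne_zero.2 Real.pi_ne_zero
  field_simp

theorem basicHypTerm_three_two (q : ℝ) (x y w b₁ b₂ z : ℂ) (n : ℕ) :
    basicHypTerm ![x, y, w] ![b₁, b₂] q z n =
      qPoch q x n * qPoch q y n * qPoch q w n * z ^ n /
        (qPoch q q n * (qPoch q b₁ n * qPoch q b₂ n)) := by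
  change (∏ i : Fin 3, qPoch q (![x, y, w] i) n) * z ^ n /
    (qPoch q q n * ∏ i : Fin 2, qPoch q (![b₁, b₂] i) n) = _
  rw [Fin.prod_univ_three, Fin.prod_univ_two]
  rfl

theorem summable_basicHypTerm_three_two (h0 : 0 < q) (h1 : q < 1) {x y w b₁ b₂ z : ℂ}
    (hb₁ : ∀ k : ℕ, b₁ * (q : ℂ) ^ k ≠ 1) (hb₂ : ∀ k : ℕ, b₂ * (q : ℂ) ^ k ≠ 1) (hz : ‖z‖ < 1) :
    Summable (basicHypTerm ![x, y, w] ![b₁, b₂] q z) := by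
  obtain ⟨C1, p1, b1⟩ := exists_norm_qPoch_le h0 h1 ‖x‖
  obtain ⟨C2, p2, b2⟩ := exists_norm_qPoch_le h0 h1 ‖y‖
  obtain ⟨C3, p3, b3⟩ := exists_norm_qPoch_le h0 h1 ‖w‖
  obtain ⟨C4, p4, b4⟩ := exists_norm_inv_qPoch_le h0 h1
    (mul_pow_ne_one h0 h1 (norm_ofReal_lt_one h0 h1))
  obtain ⟨C5, p5, b5⟩ := exists_norm_inv_qPoch_le h0 h1 hb₁
  obtain ⟨C6, p6, b6⟩ := exists_norm_inv_qPoch_le h0 h1 hb₂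
  refine Summable.of_norm_bounded ((summable_geometric_of_lt_one (norm_nonneg z) hz).mul_left
    (C1 * C2 * C3 * (C4 * (C5 * C6)))) fun n => ?_
  rw [basicHypTerm_three_two, mul_div_right_comm, div_eq_mul_inv, mul_inv, mul_inv]
  simp only [norm_mul, norm_pow]
  gcongr
  · exact b1 _ le_rfl n
  · exact b2 _ le_rfl n
  · exact b3 _ le_rfl n
  · exact b4 n
  · exact b5 n
  · exact b6 n

/-- The integrand of the five-parameter integral as a series of Rahman kernels. -/
theorem circleWeight_mul_basicHyp (h0 : 0 < q) (h1 : q < 1) {a b c d r u v α z : ℂ}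
    (ha : ‖a‖ < 1) (hs : ‖b * c * d * r‖ < 1) (hα : α * q = a ^ 2 * b * c * d * r)
    (hα1 : ∀ k : ℕ, α * (q : ℂ) ^ k ≠ 1) (hu : u ≠ 0) (hv : v ≠ 0)
    (hαu : ∀ k : ℕ, α * u * (q : ℂ) ^ k ≠ 1) (hαv : ∀ k : ℕ, α * v * (q : ℂ) ^ k ≠ 1)
    (hz : ‖z‖ = 1) :
    circleWeight q a b c d r z *
        basicHyp ![a * z, a * z⁻¹, α * u * v / q] ![α * u, α * v] q (b * c * d * r) =
      ∑' k, baileyAlpha q α u v k * (b * c * d * r) ^ k /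
        (qPochInf q (α * q) * qPochInf q (b * c * d * r)) *
          rahmanKernel q (a * (q : ℂ) ^ k) b c d r z := by
  have hz0 : z ≠ 0 := norm_pos_iff.1 (by rw [hz]; exact one_pos)
  have hxys : a * z * (a * z⁻¹) * (b * c * d * r) = α * q := by
    rw [hα]; field_simp
  rw [basicHyp, tsum_congr (basicHypTerm_three_two q _ _ _ _ _ _),
    tsum_watson_limit h0 h1 hu hv hα1 hαu hαv hs hxys, ← tsum_mul_left]
  refine tsum_congr fun k => ?_
  rw [rahmanKernel_mul_pow h0 h1 ha hz]
  ring

/-- Every product in Rahman's evaluation that involves `a` is shifted through `(tq^k;q)_∞ = (t;q)_∞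
/ (t;q)_k`. This separates the `k`-independent prefactor from the quotient of finite factorials in
the final series. -/
theorem integral_rahmanKernel_mul_pow (h0 : 0 < q) (h1 : q < 1) {a b c d r : ℂ}
    (ha : ‖a‖ < 1) (hb : ‖b‖ < 1) (hc : ‖c‖ < 1) (hd : ‖d‖ < 1) (hr : ‖r‖ < 1) (k : ℕ) :
    ∫ θ in (0 : ℝ)..Real.pi, rahmanKernel q (a * (q : ℂ) ^ k) b c d r (circleMap 0 1 θ) =
      2 * Real.pi * (qPochInf q (a * b * c * d) * qPochInf q (a * b * c * r) *
        qPochInf q (a * b * d * r) * qPochInf q (a * c * d * r) * qPochInf q (b * c * d * r)) /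
      (qPochInf q q * (qPochInf q (a * b) * qPochInf q (a * c) * qPochInf q (a * d) *
        qPochInf q (a * r) * qPochInf q (b * c) * qPochInf q (b * d) * qPochInf q (b * r) *
        qPochInf q (c * d) * qPochInf q (c * r) * qPochInf q (d * r))) *
      ((qPoch q (a * b) k * qPoch q (a * c) k * qPoch q (a * d) k * qPoch q (a * r) k) /
        (qPoch q (a * b * c * d) k * qPoch q (a * b * c * r) k * qPoch q (a * b * d * r) k *
          qPoch q (a * c * d * r) k)) := by
  have hm : ∀ s t : ℂ, ‖s‖ < 1 → ‖t‖ < 1 → ‖s * t‖ < 1 := fun s t hs ht => by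
    rw [norm_mul]; exact mul_lt_one_of_nonneg_of_lt_one_left (norm_nonneg _) hs ht.le
  have e1 : ∀ t : ℂ, ‖t‖ < 1 → qPochInf q (a * (q : ℂ) ^ k * t) =
      qPochInf q (a * t) * (qPoch q (a * t) k)⁻¹ := fun t ht => by
    rw [mul_right_comm a _ t,
      eq_mul_inv_iff_mul_eq₀ (qPoch_ne_zero_of_norm_lt h0 h1 (hm _ _ ha ht) k), mul_comm]
    exact (qPochInf_eq_mul h0 h1 (a * t) k).symm
  have e2 : ∀ x y z : ℂ, ‖x‖ < 1 → ‖y‖ < 1 → ‖z‖ < 1 → qPochInf q (a * (q : ℂ) ^ k * x * y * z) =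
      qPochInf q (a * x * y * z) * (qPoch q (a * x * y * z) k)⁻¹ := fun x y z hx hy hz => by
    have h := e1 (x * y * z) (hm _ _ (hm _ _ hx hy) hz)
    simpa only [mul_assoc] using h
  rw [integral_rahmanKernel h0 h1 (norm_mul_pow_lt_one h0 h1 ha k) hb hc hd hr,
    circleAverage_rahmanKernel h0 h1 (norm_mul_pow_lt_one h0 h1 ha k) hb hc hd hr,
    e1 b hb, e1 c hc, e1 d hd, e1 r hr, e2 b c d hb hc hd, e2 b c r hb hc hr, e2 b d r hb hd hr,
    e2 c d r hc hd hr]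
  simp only [div_eq_mul_inv, mul_inv, inv_inv]
  ring

theorem wellPoisedTerm_eq (q : ℝ) (a b c d r u v α : ℂ) (n : ℕ) :
    (1 - α * (q : ℂ) ^ (2 * n)) *
            qPochs q ![α, a * b, a * c, a * d, a * r, q / u, q / v] n /
          ((1 - α) * qPochs q
            ![(q : ℂ), a * b * c * d, a * b * c * r, a * b * d * r, a * c * d * r,
              α * u, α * v] n) *
          (-(α * b * c * d * r * u * v / q)) ^ n * (q : ℂ) ^ (n * (n - 1) / 2) =
      baileyAlpha q α u v n * (b * c * d * r) ^ n *
        ((qPoch q (a * b) n * qPoch q (a * c) n * qPoch q (a * d) n * qPoch q (a * r) n) /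
          (qPoch q (a * b * c * d) n * qPoch q (a * b * c * r) n * qPoch q (a * b * d * r) n *
            qPoch q (a * c * d * r) n)) := by
  have e : -(α * b * c * d * r * u * v / (q : ℂ)) = -(α * u * v / q) * (b * c * d * r) := by ring
  have e7 : ∀ f : Fin 7 → ℂ, qPochs q f n = qPoch q (f 0) n * qPoch q (f 1) n * qPoch q (f 2) n *
      qPoch q (f 3) n * qPoch q (f 4) n * qPoch q (f 5) n * qPoch q (f 6) n := fun f => by
    rw [qPochs, Fin.prod_univ_seven]
  rw [e, mul_pow, e7, e7]
  change (1 - α * (q : ℂ) ^ (2 * n)) * (qPoch q α n * qPoch q (a * b) n * qPoch q (a * c) n *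
      qPoch q (a * d) n * qPoch q (a * r) n * qPoch q (q / u) n * qPoch q (q / v) n) /
    ((1 - α) * (qPoch q q n * qPoch q (a * b * c * d) n * qPoch q (a * b * c * r) n *
      qPoch q (a * b * d * r) n * qPoch q (a * c * d * r) n * qPoch q (α * u) n *
      qPoch q (α * v) n)) * _ * _ = _
  simp only [baileyAlpha, div_eq_mul_inv, mul_inv]
  ring

end AskeyWilsonExpansion

/-! ### The main evaluation: termwise integration -/

theorem theorem6p3 (q : ℝ) (hq0 : 0 < q) (hq1 : q < 1)
    (a b c d r u v α : ℂ)
    (ha : ‖a‖ < 1) (hb : ‖b‖ < 1) (hc : ‖c‖ < 1) (hd : ‖d‖ < 1) (hr : ‖r‖ < 1)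
    (hα : α = a ^ 2 * b * c * d * r / (q : ℂ))
    -- the quotients `1 / (1 - α)`, `q / u`, `q / v` are defined
    (hα1 : α ≠ 1) (hu : u ≠ 0) (hv : v ≠ 0)
    -- the denominators `(α u, α v; q)_n` do not vanish
    (hαu : ∀ k : ℕ, α * u * (q : ℂ) ^ k ≠ 1) (hαv : ∀ k : ℕ, α * v * (q : ℂ) ^ k ≠ 1) :
    -- the series under the integral sign converges absolutely
    (∀ θ : ℝ, Summable (basicHypTerm
        ![a * Complex.exp (θ * Complex.I), a * Complex.exp (-(θ * Complex.I)), α * u * v / q]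
        ![α * u, α * v] q (b * c * d * r))) ∧
    -- the integral exists
    IntervalIntegrable (fun θ : ℝ =>
        hProd (Real.cos (2 * θ)) 1 q / hProds (Real.cos θ) ![a, b, c, d, r] q *
          basicHyp
            ![a * Complex.exp (θ * Complex.I), a * Complex.exp (-(θ * Complex.I)), α * u * v / q]
            ![α * u, α * v] q (b * c * d * r)) MeasureTheory.volume 0 Real.pi ∧
    -- the series on the right-hand side converges absolutely
    Summable (fun n : ℕ =>
        (1 - α * (q : ℂ) ^ (2 * n)) *
            qPochs q ![α, a * b, a * c, a * d, a * r, q / u, q / v] n /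
          ((1 - α) * qPochs q
            ![(q : ℂ), a * b * c * d, a * b * c * r, a * b * d * r, a * c * d * r,
              α * u, α * v] n) *
          (-(α * b * c * d * r * u * v / q)) ^ n * (q : ℂ) ^ (n * (n - 1) / 2)) ∧
    -- the evaluation
    (∫ θ in (0 : ℝ)..Real.pi,
        hProd (Real.cos (2 * θ)) 1 q / hProds (Real.cos θ) ![a, b, c, d, r] q *
          basicHyp
            ![a * Complex.exp (θ * Complex.I), a * Complex.exp (-(θ * Complex.I)), α * u * v / q]
            ![α * u, α * v] q (b * c * d * r)) =
      2 * (Real.pi : ℂ) *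
          qPochInfs q ![a * b * c * d, a * b * c * r, a * b * d * r, a * c * d * r] /
        qPochInfs q ![(q : ℂ), a * b, a * c, a * d, a * r, b * c, b * d, b * r, c * d, c * r,
          d * r, a ^ 2 * b * c * d * r] *
      ∑' n : ℕ,
        (1 - α * (q : ℂ) ^ (2 * n)) *
            qPochs q ![α, a * b, a * c, a * d, a * r, q / u, q / v] n /
          ((1 - α) * qPochs q
            ![(q : ℂ), a * b * c * d, a * b * c * r, a * b * d * r, a * c * d * r,
              α * u, α * v] n) *
          (-(α * b * c * d * r * u * v / q)) ^ n * (q : ℂ) ^ (n * (n - 1) / 2) := by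
  have hm : ∀ s t : ℂ, ‖s‖ < 1 → ‖t‖ < 1 → ‖s * t‖ < 1 := fun s t hs ht => by
    rw [norm_mul]; exact mul_lt_one_of_nonneg_of_lt_one_left (norm_nonneg _) hs ht.le
  have hq : (q : ℂ) ≠ 0 := Complex.ofReal_ne_zero.2 hq0.ne'
  have hs : ‖b * c * d * r‖ < 1 := hm _ _ (hm _ _ (hm _ _ hb hc) hd) hr
  have hαq : α * q = a ^ 2 * b * c * d * r := by rw [hα]; field_simp
  have hαq1 : ‖α * q‖ < 1 := by
    rw [hαq, sq]
    exact hm _ _ (hm _ _ (hm _ _ (hm _ _ (hm _ _ ha ha) hb) hc) hd) hr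
  -- Only `k = 0` needs the assumption `α ≠ 1`: `|α|` itself may exceed `1`, but `|αq| < 1`.
  have hαk : ∀ k : ℕ, α * (q : ℂ) ^ k ≠ 1 := by
    rintro (_ | k)
    · simpa using hα1
    · rw [pow_succ', ← mul_assoc]
      exact mul_pow_ne_one hq0 hq1 hαq1 k
  set s := b * c * d * r with hs_def
  set B : ℕ → ℂ := fun k => baileyAlpha q α u v k * s ^ k /
    (qPochInf q (α * q) * qPochInf q s) with hB
  have hA := summable_norm_baileyAlpha hq0 hq1 α u v hαu hαv
  have hsk : ∀ k, ‖baileyAlpha q α u v k * s ^ k‖ ≤ ‖baileyAlpha q α u v k‖ := fun k => by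
    rw [norm_mul, norm_pow]
    exact mul_le_of_le_one_right (norm_nonneg _) (pow_le_one₀ (norm_nonneg _) hs.le)
  have hBs : Summable fun k => ‖B k‖ := by
    simp only [hB, div_eq_mul_inv]
    simp only [norm_mul _ (_⁻¹)]
    exact (Summable.of_nonneg_of_le (fun _ => norm_nonneg _) hsk hA).mul_right _
  have hpt : ∀ θ : ℝ, hProd (Real.cos (2 * θ)) 1 q / hProds (Real.cos θ) ![a, b, c, d, r] q *
          basicHyp
            ![a * Complex.exp (θ * Complex.I), a * Complex.exp (-(θ * Complex.I)), α * u * v / q]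
            ![α * u, α * v] q s =
      ∑' k, B k * rahmanKernel q (a * (q : ℂ) ^ k) b c d r (circleMap 0 1 θ) := fun θ => by
    rw [hProd_div_hProds_eq_circleWeight hq0 hq1, exp_eq_circleMap, exp_neg_eq_circleMap_inv]
    exact circleWeight_mul_basicHyp hq0 hq1 ha hs hαq hαk hu hv hαu hαv (by simp)
  obtain ⟨C, hC, hC'⟩ := exists_norm_rahmanKernel_le hq0 hq1 ha hb hc hd hr
  have hbound : ∀ (k : ℕ) (θ : ℝ),
      ‖B k * rahmanKernel q (a * (q : ℂ) ^ k) b c d r (circleMap 0 1 θ)‖ ≤ ‖B k‖ * C :=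
    fun k θ => by
      rw [norm_mul]
      gcongr
      exact hC' k _ (by simp)
  have hcont : ∀ k : ℕ, Continuous fun θ : ℝ =>
      B k * rahmanKernel q (a * (q : ℂ) ^ k) b c d r (circleMap 0 1 θ) := fun k =>
    continuous_const.mul (continuous_rahmanKernel_circleMap hq0 hq1
      (norm_mul_pow_lt_one hq0 hq1 ha k) hb hc hd hr)
  have hterm := wellPoisedTerm_eq q a b c d r u v α
  simp only [hpt, hterm]
  refine ⟨fun θ => summable_basicHypTerm_three_two hq0 hq1 hαu hαv hs,
    (continuous_tsum hcont (hBs.mul_right C) hbound).intervalIntegrable _ _, ?_, ?_⟩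
  · obtain ⟨C1, p1, b1⟩ := exists_norm_qPoch_le hq0 hq1 1
    have hinv : ∀ t : ℂ, ‖t‖ < 1 → ∃ D : ℝ, 0 < D ∧ ∀ n, ‖(qPoch q t n)⁻¹‖ ≤ D := fun t ht =>
      exists_norm_inv_qPoch_le hq0 hq1 (mul_pow_ne_one hq0 hq1 ht)
    obtain ⟨D1, g1, f1⟩ := hinv (a * b * c * d) (hm _ _ (hm _ _ (hm _ _ ha hb) hc) hd)
    obtain ⟨D2, g2, f2⟩ := hinv (a * b * c * r) (hm _ _ (hm _ _ (hm _ _ ha hb) hc) hr)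
    obtain ⟨D3, g3, f3⟩ := hinv (a * b * d * r) (hm _ _ (hm _ _ (hm _ _ ha hb) hd) hr)
    obtain ⟨D4, g4, f4⟩ := hinv (a * c * d * r) (hm _ _ (hm _ _ (hm _ _ ha hc) hd) hr)
    refine Summable.of_norm_bounded
      (hA.mul_right (C1 * C1 * C1 * C1 * (D1 * D2 * D3 * D4))) fun n => ?_
    rw [norm_mul]
    refine mul_le_mul (hsk n) ?_ (norm_nonneg _) (norm_nonneg _)
    simp only [div_eq_mul_inv, mul_inv, norm_mul (qPoch q _ _), norm_mul (_ * _ : ℂ),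
      norm_mul ((_ : ℂ)⁻¹)]
    gcongr
    · exact b1 _ (hm _ _ ha hb).le n
    · exact b1 _ (hm _ _ ha hc).le n
    · exact b1 _ (hm _ _ ha hd).le n
    · exact b1 _ (hm _ _ ha hr).le n
    · exact f1 n
    · exact f2 n
    · exact f3 n
    · exact f4 n
  · have hsum := intervalIntegral.hasSum_integral_of_dominated_convergence
      (μ := MeasureTheory.volume) (a := 0) (b := Real.pi) (fun k (_ : ℝ) => ‖B k‖ * C)
      (fun k => (hcont k).aestronglyMeasurable)
      (fun k => Eventually.of_forall fun θ _ => hbound k θ)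
      (Eventually.of_forall fun _ _ => hBs.mul_right C)
      intervalIntegrable_const
      (Eventually.of_forall fun θ _ =>
        (Summable.of_norm_bounded (hBs.mul_right C) fun k => hbound k θ).hasSum)
    rw [← hsum.tsum_eq, ← tsum_mul_left]
    refine tsum_congr fun k => ?_
    -- The factor `(bcdr;q)_∞` in the numerator of Rahman's evaluation cancels the one in the
    -- `q`-Gauss denominator; the other denominator factor, `(αq;q)_∞`, is the `(a²bcdr;q)_∞` of the
    -- prefactor.
    have n1 := qPochInf_ne_zero_of_norm_lt hq0 hq1 hs
    have e12 : qPochInfs q ![(q : ℂ), a * b, a * c, a * d, a * r, b * c, b * d, b * r, c * d,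
        c * r, d * r, a ^ 2 * b * c * d * r] =
        qPochInf q q * (qPochInf q (a * b) * qPochInf q (a * c) * qPochInf q (a * d) *
        qPochInf q (a * r) * qPochInf q (b * c) * qPochInf q (b * d) * qPochInf q (b * r) *
        qPochInf q (c * d) * qPochInf q (c * r) * qPochInf q (d * r)) *
        qPochInf q (α * q) := by
      rw [hαq, qPochInfs]
      simp only [Fin.prod_univ_succ, Fin.prod_univ_zero, Matrix.cons_val_zero,
        Matrix.cons_val_succ]
      ring
    have e4 : qPochInfs q ![a * b * c * d, a * b * c * r, a * b * d * r, a * c * d * r] =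
        qPochInf q (a * b * c * d) * qPochInf q (a * b * c * r) * qPochInf q (a * b * d * r) *
          qPochInf q (a * c * d * r) := by
      rw [qPochInfs, Fin.prod_univ_four]
      rfl
    rw [intervalIntegral.integral_const_mul, integral_rahmanKernel_mul_pow hq0 hq1 ha hb hc hd hr, e12,
      e4, ← hs_def]
    simp only [hB, div_eq_mul_inv, mul_inv]
    linear_combination (2 * Real.pi * baileyAlpha q α u v k * s ^ k * (qPochInf q (α * q))⁻¹ *
      (qPochInf q (a * b * c * d) * qPochInf q (a * b * c * r) * qPochInf q (a * b * d * r) *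
          qPochInf q (a * c * d * r)) * (qPochInf q q)⁻¹ * ((qPochInf q (a * b))⁻¹ *
        (qPochInf q (a * c))⁻¹ * (qPochInf q (a * d))⁻¹ *
        (qPochInf q (a * r))⁻¹ * (qPochInf q (b * c))⁻¹ * (qPochInf q (b * d))⁻¹ *
        (qPochInf q (b * r))⁻¹ * (qPochInf q (c * d))⁻¹ * (qPochInf q (c * r))⁻¹ *
        (qPochInf q (d * r))⁻¹) *
      ((qPoch q (a * b) k * qPoch q (a * c) k * qPoch q (a * d) k * qPoch q (a * r) k) *
        ((qPoch q (a * b * c * d) k)⁻¹ * (qPoch q (a * b * c * r) k)⁻¹ *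
          (qPoch q (a * b * d * r) k)⁻¹ * (qPoch q (a * c * d * r) k)⁻¹))) *
      mul_inv_cancel₀ n1
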